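/- **Setting.** Let $k_1,\dots,k_L$ be loop momenta, $p_1,\dots,p_n$ ($n=E-1$) the independent external momenta, and let a family of $p$ propagators be given by momenta $q_a=\sum_i\alpha_{ai}k_i+\sum_j\beta_{aj}p_j$ with $\alpha_{ai},\beta_{aj}\in\{-1,0,1\}$, and squared masses $m_a^2\ge 0$. The external scales are $x=(\{p_i\cdot p_j\},\{m_a^2\})$, with real values. The family is *complete* if every dot product $k_i\cdot k_j$, $k_i\cdot p_j$ is, identically, a linear combination of $1$ and the inverse propagators $m_a^2-q_a^2$ with coefficients that are polynomials over $\mathbb{Q}$ in $x$. For $\nu\in\mathbb{Z}^p$ and $\delta>0$ put $F_{\nu}=\prod_a(m_a^2-q_a^2-i\delta)^{-\nu_a}$. In dimension $D=D_0-2\epsilon$ (with $D_0\in\mathbb{N}$, $\epsilon\in\mathbb{C}$), the integral $I_\delta(x;\nu;D)=\int\prod_{j}e^{\gamma_E\epsilon}\frac{d^Dk_j}{i\pi^{D/2}}F_\nu$ is defined for $\operatorname{Re}\epsilon\gg0$ by its Schwinger parametrisation $$e^{\gamma_EL\epsilon}\,i^{-LD/2}\int_{(0,\infty)^{\{a:\nu_a>0\}}}\prod_{\nu_a>0}\frac{i^{\nu_a}\alpha_a^{\nu_a-1}d\alpha_a}{\Gamma(\nu_a)}\Big[\prod_{\nu_a\le0}\big(i\,\partial_{\alpha_a}\big)^{-\nu_a}\,\mathcal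 U^{-D/2}e^{-i\mathcal F/\mathcal U}\Big]_{\alpha_a=0\ (\nu_a\le0)},$$ where $\mathcal U,\mathcal F$ are the Symanzik polynomials, with $m_a^2-i\delta$ in place of $m_a^2$: writing $\sum_a\alpha_aq_a^2=k^TAk+2k^TBp+p^TCp$, one has $\mathcal U=\det A$ and $\mathcal F=\mathcal U\sum_a\alpha_a(m_a^2-i\delta)-\sum_{j,l}(\mathcal UC-B^T\operatorname{adj}(A)B)_{jl}\,p_j\cdot p_l$; where $\mathcal U\le 0$ the function $\mathcal U^{-D/2}e^{-i\mathcal F/\mathcal U}$ is read as $0$. The integral $I_\delta$ is continued meromorphically in $\epsilon$. The dimensionally regularised Feynman integral $I(x;\nu;D)$ is the meromorphic function of $\epsilon\in\mathbb{C}$ that equals $\lim_{\delta\to0^+}I_\delta(x;\nu;D)$ for all non-real $\epsilon$ with $\operatorname{Re}\epsilon\ll0$. **Proposition.** Let the family be complete. Let $D_0\in\mathbb{N}$, $1\le i\le L$ and $v\in\{k_1,\dots,k_L,p_1,\dots,p_n\}$. Then there are polynomials $c_s\in\mathbb{Q}[x,\nu,\epsilon]$, $s\in\mathbb{Z}^p$,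 only finitely many of them nonzero but not all zero, with the following properties. In particular the $c_s$ are rational functions of $x$ and $\epsilon$. 1. (Total derivative.) For every integer dimension $d\ge 0$, all vectors $k_1,\dots,k_L,p_1,\dots,p_n$ of $d$-dimensional Minkowski space, all $m_a^2\ge0$, $\delta>0$ and $\nu\in\mathbb{Z}^p$, $$\sum_\mu\frac{\partial}{\partial k_i^\mu}\big[v^\mu F_\nu\big]=\sum_s c_s\,F_{\nu+s},$$ where $c_s$ is evaluated at $\nu$, at the dot products $p_j\cdot p_l$, at $m_a^2-i\delta$ in place of $m_a^2$, and at $\epsilon=(D_0-d)/2$. 2. (IBP relation for convergent integrals.) For all real scales $x$ with $m_a^2\ge0$, all $\nu\in\mathbb{Z}^p$ and $\delta>0$, there is $R$ such that for all $\epsilon$ with $\operatorname{Re}\epsilon>R$ the Schwinger parametrisations of $I_\delta(x;\nu+s;D)$ with $c_s\neq0$ converge absolutely, and $\sum_s c_s\,I_\delta(x;\nu+s;D)=0$, with $c_s$ evaluated at $\nu$, $\epsilon$, and $x$ with $m_a^2-i\delta$ in place of $m_a^2$. 3. (IBP relation in dimensional regularisation.) For all real scales $x$ with $m_a^2\ge0$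 and all $\nu\in\mathbb{Z}^p$ such that the dimensionally regularised integrals $I(x;\nu+s;D)$ with $c_s\ne0$ exist, $$\sum_s c_s(x,\nu,\epsilon)\,I(x;\nu+s;D_0-2\epsilon)=0$$ at every $\epsilon$ at which all these integrals are analytic. -/

import Mathlib

open scoped Topology

namespace Feynman

noncomputable section

/-- Labels of the momenta `t_1, …, t_K` of a family with `L` loop momenta (`Sum.inl i` is `k_i`)
and `n = E - 1` independent external momenta (`Sum.inr j` is `p_j`). -/
abbrev Mom (L n : ℕ) : Type := Fin L ⊕ Fin n

/-- Labels of the external scales: `Sum.inl s(i, j)` is the dot product `p_i · p_j` and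
`Sum.inr a` is the squared mass `m_a ^ 2`. -/
abbrev Scale (n p : ℕ) : Type := Sym2 (Fin n) ⊕ Fin p

/-- A family of `p` propagators: the momentum of propagator `a` is
`q_a = ∑ t, coeff a t • t`, over loop and independent external momenta `t`. -/
structure Family (L n p : ℕ) where
  coeff : Fin p → Mom L n → ℤ
  coeff_mem : ∀ a t, coeff a t ∈ ({-1, 0, 1} : Set ℤ)

variable {L n p : ℕ}

/-! ### Inverse propagators and completeness -/

/-- The inverse propagator `m_a ^ 2 - q_a ^ 2`, as a polynomial in the formal dot products of all
the momenta (`Sum.inl s(t, u)` is `t · u`) and the squared masses (`Sum.inr a`). -/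
def Family.invProp (F : Family L n p) (a : Fin p) :
    MvPolynomial (Sym2 (Mom L n) ⊕ Fin p) ℚ :=
  MvPolynomial.X (Sum.inr a) - ∑ t, ∑ u,
    MvPolynomial.C ((F.coeff a t : ℚ) * (F.coeff a u : ℚ)) * MvPolynomial.X (Sum.inl s(t, u))

/-- A polynomial in the external scales, as a polynomial in all dot products and masses. -/
def ofScales (L : ℕ) (r : MvPolynomial (Scale n p) ℚ) :
    MvPolynomial (Sym2 (Mom L n) ⊕ Fin p) ℚ :=
  MvPolynomial.rename (Sum.map (Sym2.map (Sum.inr : Fin n → Mom L n)) id) r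

/-- A family is complete if every dot product involving at least one loop momentum can be
expressed through the inverse propagators, with coefficients that are polynomials in the external
scales. -/
def Family.IsComplete (F : Family L n p) : Prop :=
  ∀ (i : Fin L) (t : Mom L n),
    ∃ (l : Fin p → MvPolynomial (Scale n p) ℚ) (r : MvPolynomial (Scale n p) ℚ),
      (MvPolynomial.X (Sum.inl s(Sum.inl i, t)) : MvPolynomial (Sym2 (Mom L n) ⊕ Fin p) ℚ) =
        ∑ a, ofScales L (l a) * F.invProp a + ofScales L r

/-! ### The integrand in momentum space and its total derivatives -/

/-- The Minkowski product on `ℝ ^ d`, with signature `(+, -, …, -)`. -/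
def mdot {d : ℕ} (u v : Fin d → ℝ) : ℝ :=
  ∑ μ : Fin d, (if (μ : ℕ) = 0 then 1 else -1) * (u μ * v μ)

theorem mdot_comm {d : ℕ} (u v : Fin d → ℝ) : mdot u v = mdot v u := by
  simp only [mdot, mul_comm]

/-- The external scales of a configuration of external momenta `P` and squared masses `m2`. -/
def scalesOf {d : ℕ} (P : Fin n → Fin d → ℝ) (m2 : Fin p → ℝ) : Scale n p → ℝ :=
  Sum.elim (Sym2.lift ⟨fun i j => mdot (P i) (P j), fun _ _ => mdot_comm _ _⟩) m2

/-- The Feynman prescription: `m_a ^ 2` is replaced by `m_a ^ 2 - i δ`. -/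
def shiftScales (x : Scale n p → ℝ) (δ : ℝ) : Scale n p → ℂ :=
  Sum.elim (fun e => (x (Sum.inl e) : ℂ)) (fun a => (x (Sum.inr a) : ℂ) - Complex.I * δ)

/-- The momentum `q_a` flowing through propagator `a`. -/
def Family.q (F : Family L n p) {d : ℕ} (k : Fin L → Fin d → ℝ) (P : Fin n → Fin d → ℝ)
    (a : Fin p) : Fin d → ℝ :=
  ∑ t, (F.coeff a t : ℝ) • Sum.elim k P t

/-- The integrand `∏ a, (m_a ^ 2 - q_a ^ 2 - i δ) ^ (-ν_a)`. -/
def Family.integrand (F : Family L n p) {d : ℕ} (P : Fin n → Fin d → ℝ) (m2 : Fin p → ℝ)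
    (δ : ℝ) (ν : Fin p → ℤ) (k : Fin L → Fin d → ℝ) : ℂ :=
  ∏ a, (((m2 a - mdot (F.q k P a) (F.q k P a) : ℝ) : ℂ) - Complex.I * δ) ^ (-ν a)

/-- The total derivative `∑ μ, ∂ / ∂ k_i ^ μ [v ^ μ f]`, where `v` is the loop or external
momentum labelled by `t` and `f` is a function of the loop momenta. -/
def totalDerivative {d : ℕ} (P : Fin n → Fin d → ℝ) (i : Fin L) (t : Mom L n)
    (f : (Fin L → Fin d → ℝ) → ℂ) (k : Fin L → Fin d → ℝ) : ℂ :=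
  ∑ μ, deriv (fun s : ℝ =>
    ((Sum.elim (Function.update k i (Function.update (k i) μ s)) P t μ : ℝ) : ℂ) *
      f (Function.update k i (Function.update (k i) μ s))) (k i μ)

/-! ### Dimensionally regularised Feynman integrals

The `D`-dimensional integral is defined through Schwinger parameters. With
`(z - i δ)⁻ᵛ = iᵛ / Γ(v) * ∫ α in (0, ∞), α ^ (v - 1) * exp (-i α (z - i δ))` for `v > 0`,
`z ^ m = (i ∂ / ∂ α) ^ m exp (-i α z)` at `α = 0`, and the Gaussian integral
`∫ ∏ dᴰk_j / (i π ^ (D / 2)) exp (-i ∑ α_a (m_a ^ 2 - q_a ^ 2))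
  = i ^ (-L D / 2) * U ^ (-D / 2) * exp (-i F / U)`,
the momenta disappear and `D` becomes a complex parameter. -/

/-- The `L × L` matrix of the quadratic form `∑ a, α_a q_a ^ 2` in the loop momenta. -/
def Family.loopMatrix (F : Family L n p) (α : Fin p → ℝ) : Matrix (Fin L) (Fin L) ℝ :=
  Matrix.of fun i j => ∑ a, α a * (F.coeff a (Sum.inl i) * F.coeff a (Sum.inl j))

/-- The mixed part of `∑ a, α_a q_a ^ 2`. -/
def Family.mixedMatrix (F : Family L n p) (α : Fin p → ℝ) : Matrix (Fin L) (Fin n) ℝ :=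
  Matrix.of fun i j => ∑ a, α a * (F.coeff a (Sum.inl i) * F.coeff a (Sum.inr j))

/-- The part of `∑ a, α_a q_a ^ 2` that is quadratic in the external momenta. -/
def Family.extMatrix (F : Family L n p) (α : Fin p → ℝ) : Matrix (Fin n) (Fin n) ℝ :=
  Matrix.of fun i j => ∑ a, α a * (F.coeff a (Sum.inr i) * F.coeff a (Sum.inr j))

/-- The first Symanzik polynomial `U`. -/
def Family.symanzikU (F : Family L n p) (α : Fin p → ℝ) : ℝ := (F.loopMatrix α).det

/-- The second Symanzik polynomial `F = U * ∑ a, m_a ^ 2 α_a + F'`, where `F'` does not depend on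
the masses. -/
def Family.symanzikF (F : Family L n p) (x : Scale n p → ℂ) (α : Fin p → ℝ) : ℂ :=
  (F.symanzikU α : ℂ) * ∑ a, x (Sum.inr a) * (α a : ℂ) -
    ∑ i, ∑ j, (((F.symanzikU α • F.extMatrix α -
      (F.mixedMatrix α).transpose * (F.loopMatrix α).adjugate * F.mixedMatrix α) i j : ℝ) : ℂ) *
        x (Sum.inl s(i, j))

/-- The Gaussian factor `U ^ (-D / 2) * exp (-i F / U)`. In the closed positive orthant `U ≥ 0`;
where `U` does not exceed `0` the value is `0`. -/
def Family.gaussian (F : Family L n p) (x : Scale n p → ℂ) (D : ℂ) (α : Fin p → ℝ) : ℂ :=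
  if 0 < F.symanzikU α then
    (F.symanzikU α : ℂ) ^ (-D / 2) *
      Complex.exp (-Complex.I * F.symanzikF x α / (F.symanzikU α : ℂ))
  else 0

/-- The operator `i ∂ / ∂ α_a`, which inserts the inverse propagator `a` into the integrand. -/
def insertProp (a : Fin p) (f : (Fin p → ℝ) → ℂ) : (Fin p → ℝ) → ℂ :=
  fun α => Complex.I * deriv (fun s : ℝ => f (Function.update α a s)) (α a)

/-- Insertion of the numerator `∏ (m_a ^ 2 - q_a ^ 2) ^ (-ν_a)`, over all `a` with `ν_a ≤ 0`. -/
def insertNumerator (ν : Fin p → ℤ) (f : (Fin p → ℝ) → ℂ) : (Fin p → ℝ) → ℂ :=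
  (List.finRange p).foldr (fun a g => (insertProp a)^[(-ν a).toNat] g) f

/-- The point with Schwinger parameters `α_a` where `ν_a > 0`, and `0` where `ν_a ≤ 0`. -/
def extendZero (ν : Fin p → ℤ) (α : {a : Fin p // 0 < ν a} → ℝ) : Fin p → ℝ :=
  fun a => if h : 0 < ν a then α ⟨a, h⟩ else 0

/-- The integrand of the Schwinger parametrisation in dimension `D`, a function of the Schwinger
parameters of those propagators that have a positive exponent. -/
def Family.schwingerIntegrand (F : Family L n p) (x : Scale n p → ℂ) (ν : Fin p → ℤ) (D : ℂ)
    (α : {a : Fin p // 0 < ν a} → ℝ) : ℂ :=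
  (∏ a : {a : Fin p // 0 < ν a}, Complex.I ^ (ν a) * (α a : ℂ) ^ (ν a - 1) / Complex.Gamma (ν a)) *
    insertNumerator ν (F.gaussian x D) (extendZero ν α)

/-- The domain of integration of the Schwinger parameters. -/
def orthant (ν : Fin p → ℤ) : Set ({a : Fin p // 0 < ν a} → ℝ) := {α | ∀ a, 0 < α a}

/-- The Schwinger parametrisation of the Feynman integral with exponents `ν` in dimension
`D = D₀ - 2 ε`, with `x` the scales after the Feynman prescription. It converges when the real part
of `ε` is large. -/
def Family.schwinger (F : Family L n p) (D₀ : ℕ) (x : Scale n p → ℂ) (ν : Fin p → ℤ) (ε : ℂ) : ℂ :=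
  Complex.exp (Real.eulerMascheroniConstant * L * ε) *
    Complex.I ^ (-(L : ℂ) * (D₀ - 2 * ε) / 2) *
      ∫ α in orthant ν, F.schwingerIntegrand x ν (D₀ - 2 * ε) α

/-- `I` is the dimensionally regularised Feynman integral `I(x; ν; D₀ - 2 ε)` as a meromorphic
function of `ε`. For `δ > 0`, `J δ` is the meromorphic continuation of the integral with
`m_a ^ 2 - i δ` in place of `m_a ^ 2`, from the region where its Schwinger parametrisation
converges. The limit `δ → 0+` of the Feynman prescription is taken where the real part of the
dimension is large, so that there are neither infrared nor threshold divergences, and away from the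
real axis, on which the poles lie; `I` is its meromorphic continuation. -/
def Family.IsFeynmanIntegral (F : Family L n p) (D₀ : ℕ) (x : Scale n p → ℝ) (ν : Fin p → ℤ)
    (I : ℂ → ℂ) : Prop :=
  MeromorphicOn I Set.univ ∧
  ∃ J : ℝ → ℂ → ℂ,
    (∀ δ : ℝ, 0 < δ → MeromorphicOn (J δ) Set.univ ∧
      ∃ R : ℝ, ∀ ε : ℂ, R < ε.re → J δ ε = F.schwinger D₀ (shiftScales x δ) ν ε) ∧
    ∃ R : ℝ, ∀ ε : ℂ, ε.re < R → ε.im ≠ 0 →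
      (∀ᶠ δ in 𝓝[>] (0 : ℝ), AnalyticAt ℂ (J δ) ε) ∧
      Filter.Tendsto (fun δ => J δ ε) (𝓝[>] (0 : ℝ)) (𝓝 (I ε))

/-! ### Coefficients of recursion relations -/

/-- Polynomials with rational coefficients in the external scales, the exponents
`ν_1, …, ν_p` and the dimensional regulator `ε`, in this order. -/
abbrev Coeff (n p : ℕ) : Type := MvPolynomial (Scale n p ⊕ (Fin p ⊕ Unit)) ℚ

/-- The value of a coefficient at given scales, exponents and regulator. -/
def Coeff.eval (c : Coeff n p) (x : Scale n p → ℂ) (ν : Fin p → ℤ) (ε : ℂ) : ℂ :=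
  MvPolynomial.aeval (Sum.elim x (Sum.elim (fun a => (ν a : ℂ)) (fun _ => ε))) c

end

end Feynman

/-!
By completeness every dot product of momenta is a combination of `1` and the inverse propagators,
so the derivatives of the propagators in `∑ μ, ∂ / ∂ k_i ^ μ [v ^ μ F_ν]` can be rewritten through
shifts of the exponents: a factor `a⁺` from differentiating propagator `a` and a factor `b⁻` from
each inverse propagator.

On Schwinger parametrisations, `ν_a a⁺` is multiplication by `α_a` (up to a factor `i`), because
`α ^ (ν_a - 1) / Γ(ν_a)` is multiplied by `α / ν_a` when `ν_a` is raised, and `b⁻` is the derivative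
`i ∂ / ∂ α_b`, by partial integration if `ν_b > 0` and by definition if `ν_b ≤ 0`. The relation
therefore holds for the integrals as soon as the corresponding combination of multiplications and
derivatives annihilates the Gaussian factor `U ^ (-D / 2) * exp (-i F / U)`. It does: applied to
this factor, `i ∂ / ∂ α_b` multiplies it by the inverse propagator `b` at the Gaussian expectation
values of the dot products of momenta, and the matrix of the exponent times the matrix of these
expectation values has the entries `i D δ / 2` in the rows of the loop momenta.

For large real parts of `ε` the Gaussian factor is differentiable as often as necessary and vanishes
with its derivatives where `U = 0`. The resulting relation extends to all `ε` by the identity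
theorem for meromorphic functions, and to the dimensionally regularised integrals by the limit
`δ → 0+` and another meromorphic continuation.
-/

namespace Feynman

noncomputable section

variable {L n p : ℕ}

/-! ### Reduction of dot products and the coefficients of the relations -/

/-- The polynomials `l`, `r` express every dot product of momenta, including those of two external
momenta, through the inverse propagators. -/
def Family.Reduces (F : Family L n p) (l : Mom L n → Mom L n → Fin p → MvPolynomial (Scale n p) ℚ)
    (r : Mom L n → Mom L n → MvPolynomial (Scale n p) ℚ) : Prop :=
  ∀ t u, (MvPolynomial.X (Sum.inl s(t, u)) : MvPolynomial (Sym2 (Mom L n) ⊕ Fin p) ℚ) =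
    ∑ a, ofScales L (l t u a) * F.invProp a + ofScales L (r t u)

theorem Family.IsComplete.exists_reduces {F : Family L n p} (hF : F.IsComplete) :
    ∃ l r, F.Reduces l r := by
  have reducible : ∀ t u : Mom L n, ∃ (l : Fin p → MvPolynomial (Scale n p) ℚ)
      (r : MvPolynomial (Scale n p) ℚ),
      (MvPolynomial.X (Sum.inl s(t, u)) : MvPolynomial (Sym2 (Mom L n) ⊕ Fin p) ℚ) =
        ∑ a, ofScales L (l a) * F.invProp a + ofScales L r := by
    rintro (i | j) (i' | j')
    · exact hF i _
    · exact hF i _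
    · rw [Sym2.eq_swap]
      exact hF i' _
    · exact ⟨0, MvPolynomial.X (Sum.inl s(j, j')), by simp [ofScales]⟩
  choose l r h using reducible
  exact ⟨l, r, h⟩

/-- The value of the inverse propagator `a` when the dot products have the values `N` and the
squared masses the values `m`. -/
def Family.invPropValue (F : Family L n p) (N : Sym2 (Mom L n) → ℂ) (m : Fin p → ℂ) (a : Fin p) :
    ℂ :=
  m a - ∑ t, ∑ u, (F.coeff a t : ℂ) * (F.coeff a u : ℂ) * N s(t, u)

theorem Family.invPropValue_single_diag (F : Family L n p) (t : Mom L n) (z : ℂ) (m : Fin p → ℂ)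
    (a : Fin p) :
    F.invPropValue (Pi.single s(t, t) z) m a = m a - (F.coeff a t : ℂ) ^ 2 * z := by
  simp [Family.invPropValue, Pi.single_apply, ite_and, sq]

theorem Family.Reduces.eval {F : Family L n p} {l r} (h : F.Reduces l r)
    (N : Sym2 (Mom L n) → ℂ) (x : Scale n p → ℂ)
    (hN : ∀ e, N (Sym2.map Sum.inr e) = x (Sum.inl e)) (t u : Mom L n) :
    N s(t, u) = ∑ b, MvPolynomial.aeval x (l t u b) *
      F.invPropValue N (fun a => x (Sum.inr a)) b + MvPolynomial.aeval x (r t u) := by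
  have values : (Sum.elim N fun a => x (Sum.inr a)) ∘
      (Sum.map (Sym2.map (Sum.inr : Fin n → Mom L n)) id) = x := by
    ext (e | a) <;> simp [hN]
  simpa [ofScales, MvPolynomial.aeval_rename, values, Family.invProp, Family.invPropValue] using
    congrArg (MvPolynomial.aeval (Sum.elim N fun a => x (Sum.inr a))) (h t u)

/-- The coefficients of the recursion relation that comes from the total derivative with respect to
`k_i` in the direction of the momentum `t`, for a reduction `l`, `r` of the dot products:
`D δ_{t, k_i} + ∑ a u b, 2 ν_a A_{a, k_i} A_{a u} a⁺ (l_{t u b} b⁻ + r_{t u})`, where `A` is the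
matrix of coefficients of the propagators and `a⁺`, `b⁻` shift the exponents `ν_a`, `ν_b`. -/
def Family.ibpCoeff (F : Family L n p) (l : Mom L n → Mom L n → Fin p → MvPolynomial (Scale n p) ℚ)
    (r : Mom L n → Mom L n → MvPolynomial (Scale n p) ℚ) (D₀ : ℕ) (i : Fin L) (t : Mom L n) :
    (Fin p → ℤ) →₀ Coeff n p :=
  (if t = Sum.inl i then Finsupp.single 0
    (MvPolynomial.C (D₀ : ℚ) - MvPolynomial.C 2 * MvPolynomial.X (Sum.inr (Sum.inr ()))) else 0) +
  ∑ a, ∑ u, ((∑ b, Finsupp.single (Pi.single a 1 - Pi.single b 1)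
      (MvPolynomial.C (2 * (F.coeff a (Sum.inl i) : ℚ) * (F.coeff a u : ℚ)) *
        MvPolynomial.X (Sum.inr (Sum.inl a)) * MvPolynomial.rename Sum.inl (l t u b))) +
    Finsupp.single (Pi.single a 1)
      (MvPolynomial.C (2 * (F.coeff a (Sum.inl i) : ℚ) * (F.coeff a u : ℚ)) *
        MvPolynomial.X (Sum.inr (Sum.inl a)) * MvPolynomial.rename Sum.inl (r t u)))

/-- The left-hand side `∑ s, c_s g_s` of a recursion relation, as a linear function of its
coefficients. -/
def relationSum (x : Scale n p → ℂ) (ν : Fin p → ℤ) (ε : ℂ) (g : (Fin p → ℤ) → ℂ) :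
    ((Fin p → ℤ) →₀ Coeff n p) →ₗ[ℚ] ℂ :=
  Finsupp.lsum ℚ fun s => LinearMap.mulRight ℚ (g s) ∘ₗ
    (MvPolynomial.aeval (Sum.elim x (Sum.elim (fun a => (ν a : ℂ)) fun _ => ε))).toLinearMap

theorem relationSum_apply (x : Scale n p → ℂ) (ν : Fin p → ℤ) (ε : ℂ) (g : (Fin p → ℤ) → ℂ)
    (c : (Fin p → ℤ) →₀ Coeff n p) :
    relationSum x ν ε g c = c.sum fun s b => Coeff.eval b x ν ε * g s := rfl

theorem relationSum_single (x : Scale n p → ℂ) (ν : Fin p → ℤ) (ε : ℂ) (g : (Fin p → ℤ) → ℂ)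
    (s : Fin p → ℤ) (b : Coeff n p) :
    relationSum x ν ε g (Finsupp.single s b) = Coeff.eval b x ν ε * g s := by
  simp [relationSum, Coeff.eval]

theorem Family.sum_ibpCoeff (F : Family L n p) (l r) (D₀ : ℕ) (i : Fin L) (t : Mom L n)
    (x : Scale n p → ℂ) (ν : Fin p → ℤ) (ε : ℂ) (g : (Fin p → ℤ) → ℂ) :
    ((F.ibpCoeff l r D₀ i t).sum fun s b => Coeff.eval b x ν ε * g s) =
      (if t = Sum.inl i then ((D₀ : ℂ) - 2 * ε) * g 0 else 0) +
      ∑ a, ∑ u, 2 * (F.coeff a (Sum.inl i) : ℂ) * (F.coeff a u : ℂ) * (ν a : ℂ) *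
        (∑ b, MvPolynomial.aeval x (l t u b) * g (Pi.single a 1 - Pi.single b 1) +
          MvPolynomial.aeval x (r t u) * g (Pi.single a 1)) := by
  have hinl : (Sum.elim x (Sum.elim (fun a => (ν a : ℂ)) fun _ : Unit => ε)) ∘ Sum.inl = x :=
    Sum.elim_comp_inl _ _
  rw [← relationSum_apply, Family.ibpCoeff, map_add]
  congr 1
  · split_ifs
    · rw [relationSum_single]
      simp [Coeff.eval]
    · exact map_zero _
  · simp only [map_sum, map_add, relationSum_single, Coeff.eval, map_mul,
      MvPolynomial.aeval_rename, hinl, MvPolynomial.aeval_X, Sum.elim_inr, Sum.elim_inl,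
      map_ofNat, map_intCast, mul_add, Finset.mul_sum, mul_assoc,
      mul_left_comm (ν _ : ℂ)]

theorem Family.Reduces.exists_coeff_ne_zero {F : Family L n p} {l r} (h : F.Reduces l r)
    (i : Fin L) : ∃ a, F.coeff a (Sum.inl i) ≠ 0 := by
  by_contra! hc
  have constant : ∀ z : ℂ, z = MvPolynomial.aeval (fun _ => (0 : ℂ)) (r (Sum.inl i) (Sum.inl i)) :=
    fun z => by
      simpa [invPropValue_single_diag, hc] using h.eval (Pi.single s(Sum.inl i, Sum.inl i) z)
        (fun _ => 0) (Sym2.ind fun j j' => by simp) (Sum.inl i) (Sum.inl i)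
  exact one_ne_zero ((constant 1).trans (constant 0).symm)

/- Distinct values of the relation at suitable test data separate `ibpCoeff` from `0`: the constant
function `g = 1` and the coefficient `D = 1` of `δ_{t, k_i}`, or inverse propagators equal to `1`,
so that the reduction of `t · u` sums to the value of `t · u` itself. -/
theorem Family.Reduces.ibpCoeff_ne_zero {F : Family L n p} {l r} (h : F.Reduces l r) (D₀ : ℕ)
    (i : Fin L) (t : Mom L n) : F.ibpCoeff l r D₀ i t ≠ 0 := by
  intro h0
  by_cases ht : t = Sum.inl i
  · have relation := F.sum_ibpCoeff l r D₀ i t (fun _ => 0) 0 ((D₀ - 1) / 2) fun _ => 1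
    rw [h0, Finsupp.sum_zero_index] at relation
    simp [ht, mul_div_cancel₀] at relation
  · obtain ⟨a₀, ha₀⟩ := h.exists_coeff_ne_zero i
    let N : Sym2 (Mom L n) → ℂ := Pi.single s(t, Sum.inl i) 1
    let x : Scale n p → ℂ := Sum.elim (fun e => N (Sym2.map Sum.inr e))
      fun a => 1 + ∑ t, ∑ u, (F.coeff a t : ℂ) * (F.coeff a u : ℂ) * N s(t, u)
    have reduction : ∀ u, ∑ b, MvPolynomial.aeval x (l t u b) + MvPolynomial.aeval x (r t u) =
        Pi.single (M := fun _ => ℂ) (Sum.inl i) 1 u := fun u => by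
      have hN : N s(t, u) = Pi.single (M := fun _ => ℂ) (Sum.inl i) 1 u := by
        simp only [N, Pi.single_apply, Sym2.congr_right]
      simpa [invPropValue, x, hN] using (h.eval N x (fun e => rfl) t u).symm
    have relation := F.sum_ibpCoeff l r D₀ i t x (Pi.single a₀ 1) 0 fun _ => 1
    simp [h0, ht, reduction, Pi.single_apply, ha₀] at relation

/-! ### The total derivative of the integrand -/

/-- Dot products of momenta, as a function of unordered pairs of labels. -/
def dotProducts {d : ℕ} (T : Mom L n → Fin d → ℝ) (e : Sym2 (Mom L n)) : ℂ :=
  ((Sym2.lift ⟨fun t u => mdot (T t) (T u), fun _ _ => mdot_comm _ _⟩ e : ℝ) : ℂ)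

section Minkowski

variable {d : ℕ}

theorem mdot_sum_left {ι : Type*} (s : Finset ι) (f : ι → ℝ) (T : ι → Fin d → ℝ)
    (v : Fin d → ℝ) : mdot (∑ t ∈ s, f t • T t) v = ∑ t ∈ s, f t * mdot (T t) v := by
  simp only [mdot, Finset.sum_apply, Pi.smul_apply, smul_eq_mul, Finset.mul_sum, Finset.sum_mul]
  rw [Finset.sum_comm]
  exact Finset.sum_congr rfl fun t _ => Finset.sum_congr rfl fun μ _ => by ring

theorem mdot_sum_right {ι : Type*} (s : Finset ι) (f : ι → ℝ) (T : ι → Fin d → ℝ)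
    (v : Fin d → ℝ) : mdot v (∑ t ∈ s, f t • T t) = ∑ t ∈ s, f t * mdot v (T t) := by
  rw [mdot_comm, mdot_sum_left]
  exact Finset.sum_congr rfl fun t _ => by rw [mdot_comm]

theorem mdot_single_left (μ : Fin d) (c : ℝ) (v : Fin d → ℝ) :
    mdot (Pi.single μ c) v = c * mdot (Pi.single μ 1) v := by
  simp [mdot, Pi.single_apply, mul_left_comm]

theorem sum_mul_mdot_single (u v : Fin d → ℝ) :
    ∑ μ, u μ * mdot (Pi.single μ 1) v = mdot u v := by
  simp [mdot, Pi.single_apply, mul_left_comm]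

theorem hasDerivAt_mdot {f g : ℝ → Fin d → ℝ} {f' g' : Fin d → ℝ} {s : ℝ}
    (hf : HasDerivAt f f' s) (hg : HasDerivAt g g' s) :
    HasDerivAt (fun s => mdot (f s) (g s)) (mdot f' (g s) + mdot (f s) g') s := by
  simp only [mdot, ← Finset.sum_add_distrib, ← mul_add]
  exact HasDerivAt.fun_sum fun μ _ =>
    ((hasDerivAt_pi.1 hf μ).fun_mul (hasDerivAt_pi.1 hg μ)).const_mul _

/-- The loop momenta, with the component `μ` of `k_i` replaced by `s`. -/
abbrev setComponent (k : Fin L → Fin d → ℝ) (i : Fin L) (μ : Fin d) (s : ℝ) : Fin L → Fin d → ℝ :=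
  Function.update k i (Function.update (k i) μ s)

theorem setComponent_self (k : Fin L → Fin d → ℝ) (i : Fin L) (μ : Fin d) :
    setComponent k i μ (k i μ) = k := by
  simp

theorem hasDerivAt_momentum (k : Fin L → Fin d → ℝ) (P : Fin n → Fin d → ℝ) (i : Fin L) (μ : Fin d)
    (t : Mom L n) :
    HasDerivAt (fun s => Sum.elim (setComponent k i μ s) P t)
      (if t = Sum.inl i then Pi.single μ 1 else 0) (k i μ) := by
  rcases t with j | j
  · rcases eq_or_ne j i with rfl | hj
    · simpa using hasDerivAt_update (k j) μ (k j μ)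
    · simpa [hj] using hasDerivAt_const (k i μ) (k j)
  · simpa using hasDerivAt_const (k i μ) (P j)

namespace Family

variable (F : Family L n p) (P : Fin n → Fin d → ℝ) (m2 : Fin p → ℝ)

theorem mdot_q (k : Fin L → Fin d → ℝ) (a : Fin p) (t : Mom L n) :
    ((mdot (Sum.elim k P t) (F.q k P a) : ℝ) : ℂ) =
      ∑ u, (F.coeff a u : ℂ) * dotProducts (Sum.elim k P) s(t, u) := by
  simp only [q, mdot_sum_right, dotProducts, Sym2.lift_mk, Complex.ofReal_sum, Complex.ofReal_mul,
    Complex.ofReal_intCast]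

theorem hasDerivAt_q (k : Fin L → Fin d → ℝ) (i : Fin L) (μ : Fin d) (a : Fin p) :
    HasDerivAt (fun s => F.q (setComponent k i μ s) P a)
      (Pi.single μ (F.coeff a (Sum.inl i) : ℝ)) (k i μ) := by
  refine (HasDerivAt.fun_sum fun t _ =>
    (hasDerivAt_momentum k P i μ t).const_smul (F.coeff a t : ℝ)).congr_deriv ?_
  simp [← Pi.single_smul]

/-- The denominator `m_a ^ 2 - q_a ^ 2 - i δ`. -/
def denom (δ : ℝ) (k : Fin L → Fin d → ℝ) (a : Fin p) : ℂ :=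
  ((m2 a - mdot (F.q k P a) (F.q k P a) : ℝ) : ℂ) - Complex.I * δ

variable {δ : ℝ}

theorem denom_ne_zero (hδ : δ ≠ 0) (k : Fin L → Fin d → ℝ) (a : Fin p) :
    F.denom P m2 δ k a ≠ 0 := fun h =>
  hδ (by simpa [denom] using congrArg Complex.im h)

theorem invPropValue_dotProducts (δ : ℝ) (k : Fin L → Fin d → ℝ) (a : Fin p) :
    F.invPropValue (dotProducts (Sum.elim k P))
      (fun a => shiftScales (scalesOf P m2) δ (Sum.inr a)) a = F.denom P m2 δ k a := by
  have hq : ((mdot (F.q k P a) (F.q k P a) : ℝ) : ℂ) =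
      ∑ t, ∑ u, (F.coeff a t : ℂ) * F.coeff a u * dotProducts (Sum.elim k P) s(t, u) := by
    rw [q, mdot_sum_left, ← q, Complex.ofReal_sum]
    simp only [Complex.ofReal_mul, Complex.ofReal_intCast, mdot_q, Finset.mul_sum, mul_assoc]
  rw [invPropValue, ← hq, denom, Complex.ofReal_sub, sub_right_comm]
  simp [shiftScales, scalesOf]

theorem integrand_add_single (hδ : δ ≠ 0) (ν : Fin p → ℤ) (k : Fin L → Fin d → ℝ) (a : Fin p)
    (m : ℤ) :
    F.integrand P m2 δ (ν + Pi.single a m) k =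
      F.integrand P m2 δ ν k * F.denom P m2 δ k a ^ (-m) := by
  have factor : ∀ b, F.denom P m2 δ k b ^ (-(ν + Pi.single a m : Fin p → ℤ) b) =
      F.denom P m2 δ k b ^ (-ν b) * (if b = a then F.denom P m2 δ k b ^ (-m) else 1) := by
    intro b
    rw [Pi.add_apply, neg_add, zpow_add₀ (F.denom_ne_zero P m2 hδ k b)]
    rcases eq_or_ne b a with rfl | hb <;> simp [*]
  calc F.integrand P m2 δ (ν + Pi.single a m) k
    _ = ∏ b, F.denom P m2 δ k b ^ (-(ν + Pi.single a m : Fin p → ℤ) b) := rfl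
    _ = (∏ b, F.denom P m2 δ k b ^ (-ν b)) * F.denom P m2 δ k a ^ (-m) := by
      rw [Finset.prod_congr rfl fun b _ => factor b, Finset.prod_mul_distrib,
        Finset.prod_ite_eq' Finset.univ a, if_pos (Finset.mem_univ a)]

theorem hasDerivAt_denom (δ : ℝ) (k : Fin L → Fin d → ℝ) (i : Fin L) (μ : Fin d) (a : Fin p) :
    HasDerivAt (fun s => F.denom P m2 δ (setComponent k i μ s) a)
      (-2 * F.coeff a (Sum.inl i) * mdot (Pi.single μ 1) (F.q k P a) : ℝ) (k i μ) := by
  have hq := F.hasDerivAt_q P k i μ a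
  refine (((hasDerivAt_mdot hq hq).const_sub (m2 a)).ofReal_comp.sub_const _).congr_deriv ?_
  rw [setComponent_self, mdot_comm (F.q k P a), mdot_single_left]
  congr 1
  ring

theorem hasDerivAt_integrand (hδ : δ ≠ 0) (ν : Fin p → ℤ) (k : Fin L → Fin d → ℝ) (i : Fin L)
    (μ : Fin d) :
    HasDerivAt (fun s => F.integrand P m2 δ ν (setComponent k i μ s))
      (∑ a, 2 * (F.coeff a (Sum.inl i) : ℂ) * (ν a : ℂ) *
        (mdot (Pi.single μ 1) (F.q k P a) : ℝ) *
          F.integrand P m2 δ (ν + Pi.single a 1) k) (k i μ) := by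
  have factor : ∀ a ∈ Finset.univ, HasDerivAt
      (fun s => F.denom P m2 δ (setComponent k i μ s) a ^ (-ν a))
      (((-ν a : ℤ) : ℂ) * F.denom P m2 δ k a ^ (-ν a - 1) *
        (-2 * F.coeff a (Sum.inl i) * mdot (Pi.single μ 1) (F.q k P a) : ℝ)) (k i μ) := by
    intro a _
    refine HasDerivAt.comp (h₂ := fun z : ℂ => z ^ (-ν a)) (k i μ) ?_
      (F.hasDerivAt_denom P m2 δ k i μ a)
    rw [setComponent_self]
    exact hasDerivAt_zpow (-ν a) _ (Or.inl (F.denom_ne_zero P m2 hδ k a))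
  refine (HasDerivAt.fun_finsetProd factor).congr_deriv (Finset.sum_congr rfl fun a _ => ?_)
  have split : F.integrand P m2 δ ν k =
      (∏ b ∈ Finset.univ.erase a, F.denom P m2 δ k b ^ (-ν b)) * F.denom P m2 δ k a ^ (-ν a) :=
    (Finset.prod_erase_mul _ (fun b => F.denom P m2 δ k b ^ (-ν b)) (Finset.mem_univ a)).symm
  rw [F.integrand_add_single P m2 hδ, setComponent_self, smul_eq_mul, split,
    zpow_sub₀ (F.denom_ne_zero P m2 hδ k a), zpow_neg_one, zpow_one]
  push_cast
  ring

theorem totalDerivative_integrand (hδ : δ ≠ 0) (ν : Fin p → ℤ) (k : Fin L → Fin d → ℝ) (i : Fin L)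
    (t : Mom L n) :
    totalDerivative P i t (F.integrand P m2 δ ν) k =
      (if t = Sum.inl i then (d : ℂ) * F.integrand P m2 δ ν k else 0) +
      ∑ a, ∑ u, 2 * (F.coeff a (Sum.inl i) : ℂ) * (F.coeff a u : ℂ) * (ν a : ℂ) *
        (dotProducts (Sum.elim k P) s(t, u) * F.integrand P m2 δ (ν + Pi.single a 1) k) := by
  have product_rule : ∀ μ, deriv (fun s =>
      ((Sum.elim (setComponent k i μ s) P t μ : ℝ) : ℂ) *
        F.integrand P m2 δ ν (setComponent k i μ s)) (k i μ) =
      (if t = Sum.inl i then F.integrand P m2 δ ν k else 0) +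
      ∑ a, 2 * (F.coeff a (Sum.inl i) : ℂ) * (ν a : ℂ) * F.integrand P m2 δ (ν + Pi.single a 1) k *
        (Sum.elim k P t μ * mdot (Pi.single μ 1) (F.q k P a) : ℝ) := by
    intro μ
    have hv := (hasDerivAt_pi.1 (hasDerivAt_momentum k P i μ t) μ).ofReal_comp
    rw [(hv.fun_mul (F.hasDerivAt_integrand P m2 hδ ν k i μ)).deriv, setComponent_self,
      Finset.mul_sum]
    congr 1
    · split_ifs <;> simp
    · refine Finset.sum_congr rfl fun a _ => ?_
      push_cast
      ring
  rw [totalDerivative, Finset.sum_congr rfl fun μ _ => product_rule μ, Finset.sum_add_distrib,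
    Finset.sum_comm]
  congr 1
  · split_ifs <;> simp
  · refine Finset.sum_congr rfl fun a _ => ?_
    rw [← Finset.mul_sum, ← Complex.ofReal_sum, sum_mul_mdot_single, mdot_q, Finset.mul_sum]
    exact Finset.sum_congr rfl fun u _ => by ring

theorem Reduces.totalDerivative_eq {F : Family L n p} {l r} (h : F.Reduces l r) (D₀ : ℕ)
    (i : Fin L) (t : Mom L n) (P : Fin n → Fin d → ℝ) (m2 : Fin p → ℝ) (hδ : δ ≠ 0)
    (ν : Fin p → ℤ) (k : Fin L → Fin d → ℝ) :
    totalDerivative P i t (F.integrand P m2 δ ν) k =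
      (F.ibpCoeff l r D₀ i t).sum fun s b =>
        Coeff.eval b (shiftScales (scalesOf P m2) δ) ν (((D₀ : ℂ) - d) / 2) *
          F.integrand P m2 δ (ν + s) k := by
  have reduction : ∀ u, dotProducts (Sum.elim k P) s(t, u) = _ :=
    h.eval (dotProducts (Sum.elim k P)) (shiftScales (scalesOf P m2) δ)
      (Sym2.ind fun j j' => by simp [dotProducts, shiftScales, scalesOf]) t
  have lower : ∀ a b, F.integrand P m2 δ (ν + (Pi.single a 1 - Pi.single b 1)) k =
      F.denom P m2 δ k b * F.integrand P m2 δ (ν + Pi.single a 1) k := fun a b => by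
    rw [← add_sub_assoc, sub_eq_add_neg, ← Pi.single_neg, F.integrand_add_single P m2 hδ, neg_neg,
      zpow_one, mul_comm]
  rw [F.sum_ibpCoeff l r D₀ i t _ ν _ (fun s => F.integrand P m2 δ (ν + s) k),
    F.totalDerivative_integrand P m2 hδ]
  congr 1
  · rw [add_zero, mul_div_cancel₀ _ two_ne_zero, sub_sub_cancel]
  · simp only [reduction, F.invPropValue_dotProducts, lower, add_mul, Finset.sum_mul, mul_assoc]

end Family

end Minkowski

/-! ### Polynomials in the Schwinger parameters -/

section Polynomials

open MvPolynomial

theorem pderiv_pderiv_comm {σ K : Type*} [CommRing K] (a b : σ) (P : MvPolynomial σ K) :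
    pderiv a (pderiv b P) = pderiv b (pderiv a P) := by
  classical
  have commutator : ⁅(pderiv a : Derivation K (MvPolynomial σ K) (MvPolynomial σ K)),
      (pderiv b : Derivation K (MvPolynomial σ K) (MvPolynomial σ K))⁆ = 0 := by
    refine derivation_ext fun i => ?_
    rw [Derivation.commutator_apply, pderiv_X, pderiv_X, Pi.single_apply, Pi.single_apply]
    split_ifs <;> simp
  simpa [Derivation.commutator_apply, sub_eq_zero] using DFunLike.congr_fun commutator P

variable {σ : Type*}

/-- The value of a polynomial with complex coefficients at real parameters. -/
def ev (α : σ → ℝ) : MvPolynomial σ ℂ →+* ℂ := eval fun a => (α a : ℂ)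

@[simp] theorem ev_X (α : σ → ℝ) (a : σ) : ev α (X a) = α a := by simp [ev]

@[simp] theorem ev_C (α : σ → ℝ) (c : ℂ) : ev α (C c) = c := by simp [ev]

theorem continuous_ev (P : MvPolynomial σ ℂ) : Continuous fun α : σ → ℝ => ev α P :=
  (MvPolynomial.continuous_eval P).comp (by fun_prop)

theorem hasDerivAt_ev [DecidableEq σ] (P : MvPolynomial σ ℂ) (a : σ) (α : σ → ℝ) :
    HasDerivAt (fun s => ev (Function.update α a s) P) (ev α (pderiv a P)) (α a) := by
  induction P using MvPolynomial.induction_on with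
  | C c => simpa using hasDerivAt_const (α a) c
  | add P Q hP hQ => simpa using hP.fun_add hQ
  | mul_X P b hP =>
    have hb : HasDerivAt (fun s => ((Function.update α a s b : ℝ) : ℂ))
        (ev α (pderiv a (X b))) (α a) := by
      rcases eq_or_ne b a with rfl | h
      · simpa using (hasDerivAt_id (α b)).ofReal_comp
      · simpa [h, pderiv_X_of_ne h] using hasDerivAt_const (α a) ((α b : ℝ) : ℂ)
    simp only [map_mul, ev_X]
    refine (hP.fun_mul hb).congr_deriv ?_
    rw [pderiv_mul, map_add, map_mul, map_mul, ev_X, Function.update_eq_self]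

theorem exists_norm_ev_le [Fintype σ] (P : MvPolynomial σ ℂ) :
    ∃ (C : ℝ) (k : ℕ), 1 ≤ C ∧ ∀ α : σ → ℝ, ‖ev α P‖ ≤ C * ∏ a, (1 + |α a|) ^ k := by
  refine ⟨1 + ∑ m ∈ P.support, ‖P.coeff m‖, P.totalDegree,
    le_add_of_nonneg_right (Finset.sum_nonneg fun _ _ => norm_nonneg _), fun α => ?_⟩
  have monomial_le : ∀ m ∈ P.support,
      ∏ a, |α a| ^ m a ≤ ∏ a, (1 + |α a|) ^ P.totalDegree := fun m hm =>
    Finset.prod_le_prod (fun a _ => by positivity) fun a _ =>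
      (pow_le_pow_left₀ (abs_nonneg _) (le_add_of_nonneg_left zero_le_one) _).trans
        (pow_le_pow_right₀ (le_add_of_nonneg_right (abs_nonneg _))
          ((monomial_le_degreeOf a hm).trans (degreeOf_le_totalDegree P a)))
  calc ‖ev α P‖
    _ ≤ ∑ m ∈ P.support, ‖P.coeff m‖ * ∏ a, |α a| ^ m a := by
      rw [ev, eval_eq']
      refine (norm_sum_le _ _).trans_eq (Finset.sum_congr rfl fun m _ => ?_)
      simp [norm_prod]
    _ ≤ ∑ m ∈ P.support, ‖P.coeff m‖ * ∏ a, (1 + |α a|) ^ P.totalDegree :=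
      Finset.sum_le_sum fun m hm => mul_le_mul_of_nonneg_left (monomial_le m hm) (norm_nonneg _)
    _ ≤ (1 + ∑ m ∈ P.support, ‖P.coeff m‖) * ∏ a, (1 + |α a|) ^ P.totalDegree := by
      rw [← Finset.sum_mul]
      gcongr
      exact le_add_of_nonneg_left zero_le_one

end Polynomials

/-! ### Functions of Gaussian type -/

section GaussSums

open MvPolynomial

/-- The function `P * U ^ z * exp (-i V / U)` of the Schwinger parameters, continued by zero to the
points with `U ≤ 0`, as a linear function of `P`. -/
def gaussTerm (U V : MvPolynomial (Fin p) ℂ) (z : ℂ) :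
    MvPolynomial (Fin p) ℂ →ₗ[ℂ] (Fin p → ℝ) → ℂ where
  toFun P α := if 0 < (ev α U).re then
    ev α P * (ev α U ^ z * Complex.exp (-Complex.I * ev α V / ev α U)) else 0
  map_add' P Q := by
    ext α
    by_cases hU : 0 < (ev α U).re <;> simp [hU, add_mul]
  map_smul' c P := by
    ext α
    by_cases hU : 0 < (ev α U).re <;> simp [hU, smul_eq_C_mul, mul_assoc]

/-- Formal sums `∑ P_z * U ^ z * exp (-i V / U)` of functions of Gaussian type. On formal sums the
operators `i ∂ / ∂ α_a` are polynomial and commute, whereas the functions are differentiable only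
as often as the exponents `z` allow. -/
abbrev GaussSum (p : ℕ) : Type := ℂ →₀ MvPolynomial (Fin p) ℂ

/-- The function represented by a formal sum. -/
def realize (U V : MvPolynomial (Fin p) ℂ) : GaussSum p →ₗ[ℂ] (Fin p → ℝ) → ℂ :=
  Finsupp.lsum ℂ (gaussTerm U V)

/-- The assumptions on `U` and `V`: `U` is real, and `V / U` has imaginary part at most
`-δ ∑ a, α a`, which makes `exp (-i V / U)` decay. -/
structure IsDamped (U V : MvPolynomial (Fin p) ℂ) (δ : ℝ) : Prop where
  im_eq : ∀ α, (ev α U).im = 0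
  norm_exp_le : ∀ α, 0 < (ev α U).re →
    ‖Complex.exp (-Complex.I * ev α V / ev α U)‖ ≤ Real.exp (-δ * ∑ a, α a)

/-- The formal sums whose exponents of `U` have real parts exceeding `2 N`. The operator
`i ∂ / ∂ α_a` lowers the exponents by `2`, so these can be differentiated `N` times. -/
def regular (p N : ℕ) : Submodule ℂ (GaussSum p) :=
  Finsupp.supported (MvPolynomial (Fin p) ℂ) ℂ {z | 2 * (N : ℝ) < z.re}

/-- The polynomial `Q` such that `i ∂ / ∂ α_a` maps `P * U ^ z * exp (-i V / U)` to
`Q * U ^ (z - 2) * exp (-i V / U)`, as a linear function of `P`. -/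
def insertPolynomial (U V : MvPolynomial (Fin p) ℂ) (a : Fin p) (z : ℂ) :
    Module.End ℂ (MvPolynomial (Fin p) ℂ) :=
  LinearMap.mulLeft ℂ (C Complex.I * U ^ 2) * (pderiv a).toLinearMap +
    LinearMap.mulLeft ℂ (C (Complex.I * z) * (U * pderiv a U) + (U * pderiv a V - V * pderiv a U))

/-- The operator `i ∂ / ∂ α_a` on formal sums. -/
def insertFormal (U V : MvPolynomial (Fin p) ℂ) (a : Fin p) : Module.End ℂ (GaussSum p) :=
  Finsupp.lsum ℂ fun z => Finsupp.lsingle (z - 2) ∘ₗ insertPolynomial U V a z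

variable {U V : MvPolynomial (Fin p) ℂ} {δ : ℝ}

theorem gaussTerm_apply (z : ℂ) (P : MvPolynomial (Fin p) ℂ) (α : Fin p → ℝ) :
    gaussTerm U V z P α = if 0 < (ev α U).re then
      ev α P * (ev α U ^ z * Complex.exp (-Complex.I * ev α V / ev α U)) else 0 := rfl

theorem realize_single (z : ℂ) (P : MvPolynomial (Fin p) ℂ) :
    realize U V (Finsupp.single z P) = gaussTerm U V z P := by
  simp [realize]

theorem realize_apply (f : GaussSum p) (α : Fin p → ℝ) :
    realize U V f α = ∑ z ∈ f.support, gaussTerm U V z (f z) α := by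
  simp [realize, Finsupp.lsum_apply, Finsupp.sum]

theorem realize_smul (Q : MvPolynomial (Fin p) ℂ) (f : GaussSum p) (α : Fin p → ℝ) :
    realize U V (Q • f) α = ev α Q * realize U V f α := by
  induction f using Finsupp.induction_linear with
  | zero => simp
  | add f g hf hg => simp [smul_add, hf, hg, mul_add]
  | single z P =>
    rw [Finsupp.smul_single, realize_single, realize_single, gaussTerm_apply, gaussTerm_apply,
      mul_ite, mul_zero, smul_eq_mul, map_mul, mul_assoc]

theorem insertPolynomial_apply (a : Fin p) (z : ℂ) (P : MvPolynomial (Fin p) ℂ) :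
    insertPolynomial U V a z P = C Complex.I * U ^ 2 * pderiv a P +
      (C (Complex.I * z) * (U * pderiv a U) + (U * pderiv a V - V * pderiv a U)) * P := rfl

theorem insertFormal_single (a : Fin p) (z : ℂ) (P : MvPolynomial (Fin p) ℂ) :
    insertFormal U V a (Finsupp.single z P) =
      Finsupp.single (z - 2) (insertPolynomial U V a z P) := by
  simp [insertFormal]

theorem insertPolynomial_comm (a b : Fin p) (z : ℂ) (P : MvPolynomial (Fin p) ℂ) :
    insertPolynomial U V b (z - 2) (insertPolynomial U V a z P) =
      insertPolynomial U V a (z - 2) (insertPolynomial U V b z P) := by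
  have hC : (C (2 : ℂ) : MvPolynomial (Fin p) ℂ) = 2 := map_ofNat _ 2
  simp only [insertPolynomial_apply, map_add, map_sub, pderiv_mul, pderiv_C, pderiv_pow, C_mul,
    mul_sub, hC, pderiv_pderiv_comm b a]
  ring

theorem commute_insertFormal (U V : MvPolynomial (Fin p) ℂ) (a b : Fin p) :
    Commute (insertFormal U V a) (insertFormal U V b) :=
  Finsupp.lhom_ext fun z P => by
    simp only [Module.End.mul_apply, insertFormal_single, insertPolynomial_comm a b]

theorem regular_anti {M N : ℕ} (h : M ≤ N) : regular p N ≤ regular p M :=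
  Finsupp.supported_mono fun _ => lt_of_le_of_lt (show 2 * (M : ℝ) ≤ 2 * N by gcongr)

theorem single_mem_regular {N : ℕ} {z : ℂ} (hz : 2 * (N : ℝ) < z.re) (P : MvPolynomial (Fin p) ℂ) :
    Finsupp.single z P ∈ regular p N :=
  Finsupp.single_mem_supported _ _ hz

theorem smul_mem_regular {N : ℕ} {f : GaussSum p} (hf : f ∈ regular p N)
    (Q : MvPolynomial (Fin p) ℂ) : Q • f ∈ regular p N :=
  fun _ hz => hf (Finsupp.support_smul hz)

theorem insertFormal_mem_regular {N : ℕ} {f : GaussSum p} (hf : f ∈ regular p (N + 1))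
    (a : Fin p) : insertFormal U V a f ∈ regular p N := by
  refine Submodule.sum_mem _ fun z hz => single_mem_regular ?_ _
  have hz : 2 * ((N + 1 : ℕ) : ℝ) < z.re := hf hz
  push_cast at hz
  simp only [Complex.sub_re, Complex.re_ofNat]
  linarith

theorem measurable_gaussTerm (U V : MvPolynomial (Fin p) ℂ) (z : ℂ) (P : MvPolynomial (Fin p) ℂ) :
    Measurable (gaussTerm U V z P) := by
  have hU := (continuous_ev U).measurable
  have hV := (continuous_ev V).measurable
  have hP := (continuous_ev P).measurable
  exact Measurable.ite (measurableSet_lt measurable_const (Complex.measurable_re.comp hU))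
    (by fun_prop) measurable_const

namespace IsDamped

theorem ofReal_re (h : IsDamped U V δ) (α : Fin p → ℝ) : (((ev α U).re : ℝ) : ℂ) = ev α U :=
  Complex.ext rfl (h.im_eq α).symm

theorem norm_gaussTerm_le (h : IsDamped U V δ) (z : ℂ) (P : MvPolynomial (Fin p) ℂ)
    (α : Fin p → ℝ) :
    ‖gaussTerm U V z P α‖ ≤ ‖ev α P‖ * (max (ev α U).re 0 ^ z.re * Real.exp (-δ * ∑ a, α a)) := by
  rw [gaussTerm_apply]
  split_ifs with hU
  · rw [norm_mul, norm_mul, max_eq_left hU.le, ← Complex.norm_cpow_eq_rpow_re_of_pos hU,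
      h.ofReal_re]
    gcongr
    exact h.norm_exp_le α hU
  · rw [norm_zero]
    positivity

end IsDamped

theorem hasDerivAt_gaussTerm_of_pos (z : ℂ) (P : MvPolynomial (Fin p) ℂ) (a : Fin p)
    {α : Fin p → ℝ} (hα : 0 < (ev α U).re) :
    HasDerivAt (fun s => gaussTerm U V z P (Function.update α a s))
      (-Complex.I * gaussTerm U V (z - 2) (insertPolynomial U V a z P) α) (α a) := by
  have hU := hasDerivAt_ev U a α
  have hne : ev α U ≠ 0 := fun h => by simp [h] at hα
  have hpos : ∀ᶠ s in 𝓝 (α a), 0 < (ev (Function.update α a s) U).re :=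
    (Complex.continuous_re.continuousAt.comp hU.continuousAt).eventually
      (lt_mem_nhds (by simpa using hα))
  have hpow : HasDerivAt (fun s => ev (Function.update α a s) U ^ z)
      (z * ev α U ^ (z - 1) * ev α (pderiv a U)) (α a) := by
    refine HasDerivAt.comp (h₂ := fun u : ℂ => u ^ z) (α a) ?_ hU
    rw [Function.update_eq_self]
    exact (Complex.hasStrictDerivAt_cpow_const (Or.inl hα)).hasDerivAt
  have hexp := (((hasDerivAt_ev V a α).const_mul (-Complex.I)).fun_div hU
    (by simpa using hne)).cexp
  refine (((hasDerivAt_ev P a α).fun_mul (hpow.fun_mul hexp)).congr_of_eventuallyEq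
    (hpos.mono fun s hs => by rw [gaussTerm_apply, if_pos hs])).congr_deriv ?_
  rw [gaussTerm_apply, if_pos hα, insertPolynomial_apply, Function.update_eq_self,
    Complex.cpow_sub _ _ hne, Complex.cpow_sub _ _ hne, Complex.cpow_one, Complex.cpow_ofNat]
  simp only [map_add, map_mul, map_sub, map_pow, ev_C]
  field_simp
  linear_combination ev α U ^ z * (ev α U ^ 2 * ev α (pderiv a P) +
    z * ev α U * ev α (pderiv a U) * ev α P) * Complex.I_sq

/- Where `U ≤ 0` the function is bounded by the increment of `U` to a power exceeding `1`. -/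
theorem IsDamped.hasDerivAt_gaussTerm_of_nonpos (h : IsDamped U V δ) {z : ℂ} (hz : 2 ≤ z.re)
    (P : MvPolynomial (Fin p) ℂ) (a : Fin p) {α : Fin p → ℝ} (hα : (ev α U).re ≤ 0) :
    HasDerivAt (fun s => gaussTerm U V z P (Function.update α a s)) 0 (α a) := by
  let line (s : ℝ) : Fin p → ℝ := Function.update α a s
  have increment : (fun s => ev (line s) U - ev α U) =O[𝓝 (α a)] fun s => s - α a := by
    simpa [line] using (hasDerivAt_ev U a α).isBigO_sub
  have small : ∀ᶠ s in 𝓝 (α a), ‖ev (line s) U - ev α U‖ < 1 := by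
    refine ((hasDerivAt_ev U a α).continuousAt.sub_const _).norm.eventually_lt_const ?_
    simp
  have power : (fun s => max (ev (line s) U).re 0 ^ z.re) =O[𝓝 (α a)] fun s => ‖s - α a‖ ^ 2 := by
    refine (Asymptotics.IsBigO.of_bound' (small.mono fun s hs => ?_)).trans
      (increment.norm_norm.pow 2)
    have le_increment : max (ev (line s) U).re 0 ≤ ‖ev (line s) U - ev α U‖ :=
      max_le ((le_sub_self_iff _).2 hα |>.trans (Complex.re_le_norm (ev (line s) U - ev α U)))
        (norm_nonneg _)
    rw [Real.norm_of_nonneg (by positivity), Real.norm_of_nonneg (by positivity),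
      ← Real.rpow_natCast]
    exact (Real.rpow_le_rpow (le_max_right _ _) le_increment (by linarith)).trans
      (Real.rpow_le_rpow_of_exponent_ge_of_imp (norm_nonneg _) hs.le (by exact_mod_cast hz)
        fun _ hre => by linarith)
  have bounded : (fun s => ‖ev (line s) P‖ * Real.exp (-δ * ∑ b, line s b)) =O[𝓝 (α a)]
      fun _ => (1 : ℝ) := by
    have hline : Continuous line := continuous_const.update a continuous_id
    have := (continuous_ev P).comp hline
    exact ((by fun_prop : Continuous fun s => ‖ev (line s) P‖ *
      Real.exp (-δ * ∑ b, line s b)).tendsto (α a)).isBigO_one ℝ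
  have quadratic : (fun s => gaussTerm U V z P (line s)) =O[𝓝 (α a)] fun s => ‖s - α a‖ ^ 2 := by
    refine (Asymptotics.IsBigO.of_norm_le fun s => ?_).trans
      ((bounded.mul power).congr_right fun s => one_mul _)
    exact (h.norm_gaussTerm_le z P (line s)).trans_eq (by ring)
  exact (quadratic.hasFDerivAt one_lt_two).hasDerivAt

theorem IsDamped.hasDerivAt_realize (h : IsDamped U V δ) {f : GaussSum p} (hf : f ∈ regular p 1)
    (a : Fin p) (α : Fin p → ℝ) :
    HasDerivAt (fun s => realize U V f (Function.update α a s))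
      (-Complex.I * realize U V (insertFormal U V a f) α) (α a) := by
  have term : ∀ z ∈ f.support, HasDerivAt (fun s => gaussTerm U V z (f z) (Function.update α a s))
      (-Complex.I * gaussTerm U V (z - 2) (insertPolynomial U V a z (f z)) α) (α a) := by
    intro z hz
    by_cases hα : 0 < (ev α U).re
    · exact hasDerivAt_gaussTerm_of_pos z (f z) a hα
    · have hz : 2 * ((1 : ℕ) : ℝ) < z.re := hf hz
      simpa [gaussTerm_apply _ _ α, hα] using h.hasDerivAt_gaussTerm_of_nonpos
        (by push_cast at hz; linarith) (f z) a (not_lt.1 hα)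
  simp only [realize_apply f]
  refine (HasDerivAt.fun_sum term).congr_deriv ?_
  simp [insertFormal, Finsupp.lsum_apply, Finsupp.sum, realize_single, Finset.mul_sum]

theorem IsDamped.insertProp_realize (h : IsDamped U V δ) {f : GaussSum p} (hf : f ∈ regular p 1)
    (a : Fin p) : insertProp a (realize U V f) = realize U V (insertFormal U V a f) := by
  ext α
  rw [insertProp, (h.hasDerivAt_realize hf a α).deriv, ← mul_assoc, mul_neg, Complex.I_mul_I,
    neg_neg, one_mul]

theorem IsDamped.exists_norm_gaussTerm_le (h : IsDamped U V δ) {z : ℂ} (hz : 0 ≤ z.re)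
    (P : MvPolynomial (Fin p) ℂ) : ∃ (C : ℝ) (k : ℕ), ∀ α : Fin p → ℝ,
      ‖gaussTerm U V z P α‖ ≤ C * ∏ a, ((1 + |α a|) ^ k * Real.exp (-δ * α a)) := by
  obtain ⟨C, k, -, hP⟩ := exists_norm_ev_le P
  obtain ⟨C', k', hC', hU⟩ := exists_norm_ev_le U
  obtain ⟨N, hN⟩ := exists_nat_ge z.re
  refine ⟨C * C' ^ N, k + k' * N, fun α => (h.norm_gaussTerm_le z P α).trans ?_⟩
  have one_le : 1 ≤ C' * ∏ a, (1 + |α a|) ^ k' :=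
    one_le_mul_of_one_le_of_one_le hC' (Finset.one_le_prod fun a _ =>
      one_le_pow₀ (le_add_of_nonneg_right (abs_nonneg _)))
  have power_le : max (ev α U).re 0 ^ z.re ≤ (C' * ∏ a, (1 + |α a|) ^ k') ^ N := by
    rw [← Real.rpow_natCast]
    refine (Real.rpow_le_rpow (le_max_right _ _) (max_le ?_ ?_) hz).trans
      (Real.rpow_le_rpow_of_exponent_le one_le hN)
    · exact (Complex.re_le_norm _).trans (hU α)
    · exact zero_le_one.trans one_le
  calc _ ≤ (C * ∏ a, (1 + |α a|) ^ k) *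
        ((C' * ∏ a, (1 + |α a|) ^ k') ^ N * ∏ a, Real.exp (-δ * α a)) := by
        rw [← Real.exp_sum, ← Finset.mul_sum]
        gcongr
        · exact (norm_nonneg _).trans (hP α)
        · exact hP α
    _ = _ := by
        simp only [mul_pow, ← Finset.prod_pow, Finset.prod_mul_distrib, pow_add, pow_mul]
        ring

end GaussSums

/-! ### Numerators on formal sums -/

section Numerators

open MvPolynomial

/-- The total degree of the numerator `∏ (m_a ^ 2 - q_a ^ 2) ^ (-ν_a)`, over all `a` with
`ν_a ≤ 0`. -/
def numeratorDegree (ν : Fin p → ℤ) : ℕ := ∑ a, (-ν a).toNat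

/-- The operator `insertNumerator ν` on formal sums. -/
def insertNumeratorFormal (U V : MvPolynomial (Fin p) ℂ) (ν : Fin p → ℤ) :
    Module.End ℂ (GaussSum p) :=
  Finset.univ.noncommProd (fun a => insertFormal U V a ^ (-ν a).toNat)
    fun a _ b _ _ => (commute_insertFormal U V a b).pow_pow _ _

/-- Multiplication by the Schwinger parameter `α_a` on formal sums. -/
def mulParam (a : Fin p) : Module.End ℂ (GaussSum p) :=
  DistribSMul.toLinearMap ℂ (GaussSum p) (X a : MvPolynomial (Fin p) ℂ)

/-- The rewriting of `P * U ^ z` as `(P * U ^ 2) * U ^ (z - 2)`. It does not change the function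
represented by a formal sum, and makes the product rule for `i ∂ / ∂ α_a` an identity between
formal sums. -/
def lowerExponent (U : MvPolynomial (Fin p) ℂ) : Module.End ℂ (GaussSum p) :=
  Finsupp.lsum ℂ fun z => Finsupp.lsingle (z - 2) ∘ₗ LinearMap.mulLeft ℂ (U ^ 2)

variable {U V : MvPolynomial (Fin p) ℂ} {δ : ℝ}

theorem mulParam_apply (a : Fin p) (f : GaussSum p) :
    mulParam a f = (X a : MvPolynomial (Fin p) ℂ) • f := rfl

theorem lowerExponent_single (z : ℂ) (P : MvPolynomial (Fin p) ℂ) :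
    lowerExponent U (Finsupp.single z P) = Finsupp.single (z - 2) (U ^ 2 * P) := by
  simp [lowerExponent]

theorem realize_mulParam (a : Fin p) (f : GaussSum p) (α : Fin p → ℝ) :
    realize U V (mulParam a f) α = α a * realize U V f α := by
  rw [mulParam_apply, realize_smul, ev_X]

theorem realize_lowerExponent (f : GaussSum p) :
    realize U V (lowerExponent U f) = realize U V f := by
  induction f using Finsupp.induction_linear with
  | zero => simp
  | add f g hf hg => simp only [map_add, hf, hg]
  | single z P =>
    ext α
    rw [lowerExponent_single, realize_single, realize_single, gaussTerm_apply, gaussTerm_apply]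
    split_ifs with hU
    · have hne : ev α U ≠ 0 := fun h => by simp [h] at hU
      rw [Complex.cpow_sub _ _ hne, Complex.cpow_ofNat, map_mul, map_pow]
      field_simp
    · rfl

theorem mulParam_mem_regular {N : ℕ} {f : GaussSum p} (hf : f ∈ regular p N) (a : Fin p) :
    mulParam a f ∈ regular p N :=
  smul_mem_regular hf _

theorem commute_insertFormal_lowerExponent (a : Fin p) :
    Commute (insertFormal U V a) (lowerExponent U) :=
  Finsupp.lhom_ext fun z P => by
    have hC : (C (2 : ℂ) : MvPolynomial (Fin p) ℂ) = 2 := map_ofNat _ 2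
    simp only [Module.End.mul_apply, insertFormal_single, lowerExponent_single,
      insertPolynomial_apply, pderiv_mul, pderiv_pow, mul_sub, C_mul, C_sub, hC]
    refine congrArg _ ?_
    ring

theorem commute_insertFormal_mulParam {a b : Fin p} (hab : b ≠ a) :
    Commute (insertFormal U V b) (mulParam a) :=
  Finsupp.lhom_ext fun z P => by
    simp only [Module.End.mul_apply, mulParam_apply, Finsupp.smul_single, insertFormal_single,
      insertPolynomial_apply, smul_eq_mul, pderiv_mul, pderiv_X_of_ne hab.symm]
    refine congrArg _ ?_
    ring

theorem insertFormal_mul_mulParam (a : Fin p) :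
    insertFormal U V a * mulParam a = mulParam a * insertFormal U V a +
      Complex.I • lowerExponent U :=
  Finsupp.lhom_ext fun z P => by
    simp only [Module.End.mul_apply, LinearMap.add_apply, LinearMap.smul_apply, mulParam_apply,
      Finsupp.smul_single, insertFormal_single, lowerExponent_single, insertPolynomial_apply,
      smul_eq_mul, pderiv_mul, pderiv_X_self, ← Finsupp.single_add, smul_eq_C_mul]
    refine congrArg _ ?_
    ring

theorem insertFormal_pow_mul_mulParam (a : Fin p) (m : ℕ) :
    insertFormal U V a ^ m * mulParam a = mulParam a * insertFormal U V a ^ m +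
      (Complex.I * m) • (lowerExponent U * insertFormal U V a ^ (m - 1)) := by
  induction m with
  | zero => simp
  | succ m ih =>
    have collect : (Complex.I * m) • (lowerExponent U *
        (insertFormal U V a * insertFormal U V a ^ (m - 1))) =
        (Complex.I * m) • (lowerExponent U * insertFormal U V a ^ m) := by
      rcases m with _ | m
      · simp
      · rw [Nat.add_sub_cancel, ← pow_succ']
    rw [pow_succ', mul_assoc, ih, mul_add, ← mul_assoc, insertFormal_mul_mulParam, add_mul,
      mul_smul_comm, ← mul_assoc, (commute_insertFormal_lowerExponent a).eq, mul_assoc, mul_assoc,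
      collect, smul_mul_assoc, add_assoc, ← add_smul, Nat.add_sub_cancel]
    push_cast
    ring_nf

/-- The operator `insertNumerator ν` without the propagator `a`, on formal sums. -/
def insertNumeratorErase (U V : MvPolynomial (Fin p) ℂ) (ν : Fin p → ℤ) (a : Fin p) :
    Module.End ℂ (GaussSum p) :=
  (Finset.univ.erase a).noncommProd (fun b => insertFormal U V b ^ (-ν b).toNat)
    fun b _ c _ _ => (commute_insertFormal U V b c).pow_pow _ _

theorem insertNumeratorFormal_eq_mul (ν : Fin p → ℤ) (a : Fin p) :
    insertNumeratorFormal U V ν =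
      insertFormal U V a ^ (-ν a).toNat * insertNumeratorErase U V ν a :=
  (Finset.mul_noncommProd_erase _ (Finset.mem_univ a) _ _ _).symm

theorem insertNumeratorErase_congr {ν ν' : Fin p → ℤ} {a : Fin p} (h : ∀ b ≠ a, ν b = ν' b) :
    insertNumeratorErase U V ν a = insertNumeratorErase U V ν' a :=
  Finset.noncommProd_congr rfl (fun b hb => by rw [h b (Finset.ne_of_mem_erase hb)]) _

theorem commute_mulParam_insertNumeratorErase (ν : Fin p → ℤ) (a : Fin p) :
    Commute (mulParam a) (insertNumeratorErase U V ν a) :=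
  Finset.noncommProd_commute _ _ _ _ fun _ hb =>
    ((commute_insertFormal_mulParam (Finset.ne_of_mem_erase hb)).pow_left _).symm

theorem commute_insertFormal_insertNumeratorFormal (ν : Fin p → ℤ) (a : Fin p) :
    Commute (insertFormal U V a) (insertNumeratorFormal U V ν) :=
  Finset.noncommProd_commute _ _ _ _ fun b _ => (commute_insertFormal U V a b).pow_right _

theorem insertNumeratorFormal_lower {ν : Fin p → ℤ} {a : Fin p} (ha : ν a ≤ 0) :
    insertNumeratorFormal U V (ν - Pi.single a 1) =
      insertNumeratorFormal U V ν * insertFormal U V a := by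
  rw [← (commute_insertFormal_insertNumeratorFormal ν a).eq, insertNumeratorFormal_eq_mul _ a,
    insertNumeratorFormal_eq_mul ν a, insertNumeratorErase_congr (ν' := ν) (by simp +contextual),
    ← mul_assoc, ← pow_succ']
  congr 2
  simp
  omega

theorem insertNumeratorFormal_congr_of_pos {ν ν' : Fin p → ℤ} {a : Fin p} (ha : 0 ≤ ν a)
    (ha' : 0 ≤ ν' a) (h : ∀ b ≠ a, ν b = ν' b) :
    insertNumeratorFormal U V ν = insertNumeratorFormal U V ν' := by
  rw [insertNumeratorFormal_eq_mul ν a, insertNumeratorFormal_eq_mul ν' a,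
    insertNumeratorErase_congr h, Int.toNat_of_nonpos (by omega), Int.toNat_of_nonpos (by omega)]

theorem insertNumeratorFormal_mul_mulParam (ν : Fin p → ℤ) (a : Fin p) :
    insertNumeratorFormal U V ν * mulParam a = mulParam a * insertNumeratorFormal U V ν +
      (Complex.I * (-ν a).toNat) •
        (lowerExponent U * insertNumeratorFormal U V (ν + Pi.single a 1)) := by
  rw [insertNumeratorFormal_eq_mul ν a, insertNumeratorFormal_eq_mul (ν + Pi.single a 1) a,
    insertNumeratorErase_congr (ν := ν + Pi.single a 1) (ν' := ν) (by simp +contextual), mul_assoc,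
    ← (commute_mulParam_insertNumeratorErase ν a).eq, ← mul_assoc, insertFormal_pow_mul_mulParam,
    add_mul, smul_mul_assoc, mul_assoc, mul_assoc]
  congr 5
  simp
  omega

theorem insertNumeratorFormal_eq_prod (ν : Fin p → ℤ) :
    insertNumeratorFormal U V ν =
      ((List.finRange p).map fun a => insertFormal U V a ^ (-ν a).toNat).prod := by
  rw [← Finset.noncommProd_toFinset _ _
    (fun a _ b _ _ => (commute_insertFormal U V a b).pow_pow _ _) (List.nodup_finRange p)]
  exact Finset.noncommProd_congr (List.toFinset_finRange p).symm (fun _ _ => rfl) _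

theorem numeratorDegree_eq_sum (ν : Fin p → ℤ) :
    numeratorDegree ν = ((List.finRange p).map fun a => (-ν a).toNat).sum := by
  rw [numeratorDegree, ← List.sum_toFinset _ (List.nodup_finRange p), List.toFinset_finRange]

theorem insertFormal_pow_mem_regular (a : Fin p) {m N : ℕ} {f : GaussSum p}
    (hf : f ∈ regular p (N + m)) : (insertFormal U V a ^ m) f ∈ regular p N := by
  induction m generalizing f with
  | zero => exact hf
  | succ m ih => exact pow_succ (insertFormal U V a) m ▸ ih (insertFormal_mem_regular hf a)

theorem prod_insertFormal_mem_regular (m : Fin p → ℕ) (l : List (Fin p)) {N : ℕ} {f : GaussSum p}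
    (hf : f ∈ regular p (N + (l.map m).sum)) :
    (l.map fun a => insertFormal U V a ^ m a).prod f ∈ regular p N := by
  induction l generalizing N with
  | nil => exact hf
  | cons a l ih =>
    rw [List.map_cons, List.sum_cons, ← add_assoc] at hf
    exact insertFormal_pow_mem_regular a (ih hf)

theorem insertNumeratorFormal_mem_regular {ν : Fin p → ℤ} {N : ℕ} {f : GaussSum p}
    (hf : f ∈ regular p (N + numeratorDegree ν)) : insertNumeratorFormal U V ν f ∈ regular p N := by
  rw [numeratorDegree_eq_sum] at hf
  rw [insertNumeratorFormal_eq_prod]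
  exact prod_insertFormal_mem_regular _ _ hf

namespace IsDamped

theorem iterate_insertProp_realize (h : IsDamped U V δ) (a : Fin p) {m : ℕ} {f : GaussSum p}
    (hf : f ∈ regular p m) :
    (insertProp a)^[m] (realize U V f) = realize U V ((insertFormal U V a ^ m) f) := by
  induction m generalizing f with
  | zero => rfl
  | succ m ih =>
    rw [Function.iterate_succ_apply, h.insertProp_realize (regular_anti (by omega) hf),
      ih (insertFormal_mem_regular hf a), pow_succ, Module.End.mul_apply]

theorem foldr_insertProp_realize (h : IsDamped U V δ) (m : Fin p → ℕ) (l : List (Fin p))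
    {f : GaussSum p} (hf : f ∈ regular p (l.map m).sum) :
    l.foldr (fun a g => (insertProp a)^[m a] g) (realize U V f) =
      realize U V ((l.map fun a => insertFormal U V a ^ m a).prod f) := by
  induction l with
  | nil => rfl
  | cons a l ih =>
    rw [List.map_cons, List.sum_cons] at hf
    rw [List.foldr_cons, ih (regular_anti (Nat.le_add_left _ _) hf),
      h.iterate_insertProp_realize a (prod_insertFormal_mem_regular m l hf)]
    rfl

theorem insertNumerator_realize (h : IsDamped U V δ) {ν : Fin p → ℤ} {f : GaussSum p}
    (hf : f ∈ regular p (numeratorDegree ν)) :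
    insertNumerator ν (realize U V f) = realize U V (insertNumeratorFormal U V ν f) := by
  rw [numeratorDegree_eq_sum] at hf
  rw [insertNumeratorFormal_eq_prod, ← h.foldr_insertProp_realize _ _ hf, insertNumerator]

end IsDamped

end Numerators

/-! ### Schwinger integrals -/

section Schwinger

open MeasureTheory

/-- The measure of a Schwinger parameter with exponent `m`: Lebesgue measure on `(0, ∞)` if `m > 0`,
and otherwise the point mass at `0`, where the numerators are evaluated. -/
def schwingerMeasure (m : ℤ) : Measure ℝ :=
  if 0 < m then volume.restrict (Set.Ioi 0) else Measure.dirac 0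

instance (m : ℤ) : SigmaFinite (schwingerMeasure m) := by
  unfold schwingerMeasure
  split_ifs <;> infer_instance

/-- The weight of a Schwinger parameter with exponent `m`. -/
def schwingerWeight (m : ℤ) (s : ℝ) : ℂ :=
  if 0 < m then Complex.I ^ m * (s : ℂ) ^ (m - 1) / Complex.Gamma m else 1

theorem schwingerMeasure_of_pos {m : ℤ} (hm : 0 < m) :
    schwingerMeasure m = volume.restrict (Set.Ioi 0) := if_pos hm

theorem schwingerMeasure_of_nonpos {m : ℤ} (hm : m ≤ 0) :
    schwingerMeasure m = Measure.dirac 0 := if_neg hm.not_gt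

theorem schwingerWeight_of_nonpos {m : ℤ} (hm : m ≤ 0) (s : ℝ) : schwingerWeight m s = 1 :=
  if_neg hm.not_gt

theorem schwingerWeight_natCast_succ (j : ℕ) (s : ℝ) :
    schwingerWeight (j + 1) s = Complex.I ^ (j + 1) / (j.factorial : ℂ) * (s : ℂ) ^ j := by
  rw [schwingerWeight, if_pos (by positivity), add_sub_cancel_right, zpow_natCast,
    ← Nat.cast_add_one, zpow_natCast]
  push_cast
  rw [Complex.Gamma_nat_eq_factorial]
  ring

theorem schwingerWeight_one (s : ℝ) : schwingerWeight 1 s = Complex.I := by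
  simpa using schwingerWeight_natCast_succ 0 s

theorem schwingerWeight_mul_self {m : ℤ} (hm : 0 < m) (s : ℝ) :
    schwingerWeight m s * s = -Complex.I * m * schwingerWeight (m + 1) s := by
  obtain ⟨j, rfl⟩ : ∃ j : ℕ, m = j + 1 := ⟨(m - 1).toNat, by omega⟩
  have hj : (j : ℂ) + 1 ≠ 0 := by exact_mod_cast j.succ_ne_zero
  rw [← Nat.cast_add_one, schwingerWeight_natCast_succ (j + 1), Nat.cast_add_one,
    schwingerWeight_natCast_succ, Nat.factorial_succ]
  push_cast
  field_simp
  linear_combination Complex.I ^ (j + 1) * (s : ℂ) ^ (j + 1) / (j.factorial : ℂ) * Complex.I_sq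

theorem hasDerivAt_schwingerWeight {m : ℤ} (hm : 1 < m) (s : ℝ) :
    HasDerivAt (schwingerWeight m) (Complex.I * schwingerWeight (m - 1) s) s := by
  obtain ⟨j, rfl⟩ : ∃ j : ℕ, m = j + 1 + 1 := ⟨(m - 2).toNat, by omega⟩
  have hj : (j : ℂ) + 1 ≠ 0 := by exact_mod_cast j.succ_ne_zero
  rw [add_sub_cancel_right, schwingerWeight_natCast_succ, ← Nat.cast_add_one,
    funext (schwingerWeight_natCast_succ _)]
  refine (((hasDerivAt_pow (j + 1) (s : ℂ)).comp_ofReal).const_mul _).congr_deriv ?_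
  rw [Nat.factorial_succ]
  push_cast
  field_simp
  ring_nf

theorem continuous_schwingerWeight (m : ℤ) : Continuous (schwingerWeight m) := by
  rcases lt_trichotomy m 1 with hm | rfl | hm
  · simpa only [funext (schwingerWeight_of_nonpos (Int.lt_add_one_iff.1 hm))] using
      continuous_const
  · simpa only [funext schwingerWeight_one] using continuous_const
  · exact continuous_iff_continuousAt.2 fun s => (hasDerivAt_schwingerWeight hm s).continuousAt

theorem schwingerWeight_apply_zero {m : ℤ} (hm : 1 < m) : schwingerWeight m 0 = 0 := by
  rw [schwingerWeight, if_pos (by omega), Complex.ofReal_zero, zero_zpow _ (by omega), mul_zero,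
    zero_div]

/-- The boundary term at `0` vanishes for `m > 1` and gives the point mass for `m = 1`. -/
theorem integral_schwingerWeight_mul_deriv {m : ℤ} (hm : 0 < m) {g g' : ℝ → ℂ}
    (hg : ∀ s, HasDerivAt g (-Complex.I * g' s) s)
    (hint : Integrable (fun s => schwingerWeight m s * g s) (schwingerMeasure m))
    (hint' : Integrable (fun s => schwingerWeight m s * g' s) (schwingerMeasure m))
    (hlow : Integrable (fun s => schwingerWeight (m - 1) s * g s) (schwingerMeasure (m - 1))) :
    ∫ s, schwingerWeight m s * g' s ∂schwingerMeasure m =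
      ∫ s, schwingerWeight (m - 1) s * g s ∂schwingerMeasure (m - 1) := by
  rw [schwingerMeasure_of_pos hm] at hint hint' ⊢
  obtain rfl | hm1 : m = 1 ∨ 1 < m := by omega
  · rw [schwingerMeasure_of_nonpos (by simp), integral_dirac, schwingerWeight_of_nonpos (by simp),
      one_mul]
    simp only [schwingerWeight_one] at hint hint' ⊢
    have deriv (s : ℝ) : HasDerivAt (fun s => Complex.I * g s) (g' s) s :=
      ((hg s).const_mul Complex.I).congr_deriv (by linear_combination -g' s * Complex.I_sq)
    have hderiv := (integrable_const_mul_iff Complex.I_ne_zero.isUnit _).1 hint'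
    have boundary := integral_Ioi_of_hasDerivAt_of_tendsto' (fun s _ => deriv s) hderiv
      (tendsto_zero_of_hasDerivAt_of_integrableOn_Ioi (a := 0) (fun s _ => deriv s) hderiv hint)
    rw [integral_const_mul, boundary]
    linear_combination -g 0 * Complex.I_sq
  · rw [schwingerMeasure_of_pos (by omega)] at hlow ⊢
    have deriv (s : ℝ) : HasDerivAt (fun s => schwingerWeight m s * g s)
        (Complex.I * (schwingerWeight (m - 1) s * g s) +
          -Complex.I * (schwingerWeight m s * g' s)) s :=
      ((hasDerivAt_schwingerWeight hm1 s).mul (hg s)).congr_deriv (by ring)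
    have hderiv := (hlow.const_mul Complex.I).add (hint'.const_mul (-Complex.I))
    have boundary := integral_Ioi_of_hasDerivAt_of_tendsto' (fun s _ => deriv s) hderiv
      (tendsto_zero_of_hasDerivAt_of_integrableOn_Ioi (a := 0) (fun s _ => deriv s) hderiv hint)
    rw [integral_add (hlow.const_mul _) (hint'.const_mul _), integral_const_mul,
      integral_const_mul, schwingerWeight_apply_zero hm1] at boundary
    refine mul_left_cancel₀ Complex.I_ne_zero ?_
    linear_combination -boundary

theorem integrableOn_Ioi_pow_mul_exp {δ : ℝ} (hδ : 0 < δ) (k : ℕ) :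
    IntegrableOn (fun s : ℝ => (1 + |s|) ^ k * Real.exp (-δ * s)) (Set.Ioi 0) := by
  refine integrable_of_isBigO_exp_neg (b := δ / 2) (half_pos hδ) (by fun_prop) ?_
  have linear : (fun s : ℝ => 1 + |s|) =O[Filter.atTop] fun s => s := by
    refine Asymptotics.IsBigO.of_bound 2 (Filter.eventually_ge_atTop 1 |>.mono fun s hs => ?_)
    rw [Real.norm_of_nonneg (by positivity), Real.norm_eq_abs]
    linarith [le_abs_self s]
  have power : (fun s : ℝ => (1 + |s|) ^ k) =O[Filter.atTop] fun s => Real.exp (δ / 2 * s) :=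
    (linear.pow k).trans (isLittleO_pow_exp_pos_mul_atTop k (half_pos hδ)).isBigO
  refine (power.mul (Asymptotics.isBigO_refl (fun s => Real.exp (-δ * s)) _)).congr_right
    fun s => ?_
  rw [← Real.exp_add]
  ring_nf

theorem integrable_norm_schwingerWeight_mul {δ : ℝ} (hδ : 0 < δ) (m : ℤ) (k : ℕ) :
    Integrable (fun s : ℝ => ‖schwingerWeight m s‖ * ((1 + |s|) ^ k * Real.exp (-δ * s)))
      (schwingerMeasure m) := by
  rcases le_or_gt m 0 with hm | hm
  · rw [schwingerMeasure_of_nonpos hm]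
    exact integrable_dirac (by simp)
  rw [schwingerMeasure_of_pos hm]
  obtain ⟨j, rfl⟩ : ∃ j : ℕ, m = j + 1 := ⟨(m - 1).toNat, by omega⟩
  have hw := continuous_schwingerWeight (j + 1)
  refine ((integrableOn_Ioi_pow_mul_exp hδ (j + k)).const_mul
    ‖Complex.I ^ (j + 1) / (j.factorial : ℂ)‖).mono'
      (by fun_prop : Continuous _).aestronglyMeasurable (Filter.Eventually.of_forall fun s => ?_)
  rw [schwingerWeight_natCast_succ, Real.norm_of_nonneg (by positivity), norm_mul, norm_pow,
    Complex.norm_real, Real.norm_eq_abs, pow_add (1 + |s|), mul_assoc, mul_assoc ((1 + |s|) ^ j)]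
  gcongr
  exact le_add_of_nonneg_left zero_le_one

end Schwinger

section SchwingerIntegral

open MeasureTheory

/-- The product of the weights of all Schwinger parameters. -/
def schwingerWeightProd (ν : Fin p → ℤ) (α : Fin p → ℝ) : ℂ := ∏ a, schwingerWeight (ν a) (α a)

/-- The product of the measures of all Schwinger parameters. -/
abbrev schwingerMeasurePi (ν : Fin p → ℤ) : Measure (Fin p → ℝ) :=
  Measure.pi fun a => schwingerMeasure (ν a)

/-- Integrability against the weights of exponents `ν`. -/
def SchwingerIntegrable (ν : Fin p → ℤ) (g : (Fin p → ℝ) → ℂ) : Prop :=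
  Integrable (fun α => schwingerWeightProd ν α * g α) (schwingerMeasurePi ν)

/-- The integral against the weights of exponents `ν`. -/
def schwingerIntegral (ν : Fin p → ℤ) (g : (Fin p → ℝ) → ℂ) : ℂ :=
  ∫ α, schwingerWeightProd ν α * g α ∂schwingerMeasurePi ν

variable {δ : ℝ}

theorem schwingerIntegrable_of_norm_le (hδ : 0 < δ) (ν : Fin p → ℤ) {g : (Fin p → ℝ) → ℂ}
    (hg : Measurable g) {C : ℝ} {k : ℕ}
    (hC : ∀ α : Fin p → ℝ, ‖g α‖ ≤ C * ∏ a, ((1 + |α a|) ^ k * Real.exp (-δ * α a))) :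
    SchwingerIntegrable ν g := by
  refine ((Integrable.fintype_prod_dep fun a =>
    integrable_norm_schwingerWeight_mul hδ (ν a) k).const_mul C).mono' ?_
      (Filter.Eventually.of_forall fun α => ?_)
  · exact ((Finset.measurable_fun_prod _ fun a _ =>
      (continuous_schwingerWeight (ν a)).measurable.comp (measurable_pi_apply a)).mul
        hg).aestronglyMeasurable
  · rw [norm_mul, schwingerWeightProd, norm_prod, Finset.prod_mul_distrib, mul_left_comm]
    gcongr
    exact hC α

section Fubini

variable {E X : Type*} [NormedAddCommGroup E] [MeasurableSpace X] {q : ℕ}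
  {μ : Fin (q + 1) → Measure X} [∀ i, SigmaFinite (μ i)] {f : (Fin (q + 1) → X) → E}

theorem integrable_comp_insertNth (hf : Integrable f (Measure.pi μ)) (a : Fin (q + 1)) :
    Integrable (fun z : X × (Fin q → X) => f (a.insertNth z.1 z.2))
      ((μ a).prod (Measure.pi fun j => μ (a.succAbove j))) :=
  ((measurePreserving_piFinSuccAbove μ a).symm.integrable_comp_emb
    (MeasurableEquiv.measurableEmbedding _)).2 hf

theorem integral_pi_eq_integral_insertNth [NormedSpace ℝ E] (hf : Integrable f (Measure.pi μ))
    (a : Fin (q + 1)) :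
    ∫ α, f α ∂Measure.pi μ =
      ∫ y, ∫ s, f (a.insertNth s y) ∂μ a ∂Measure.pi fun j => μ (a.succAbove j) := by
  rw [← (measurePreserving_piFinSuccAbove μ a).symm.integral_comp
    (MeasurableEquiv.measurableEmbedding _)]
  exact integral_prod_symm _ (integrable_comp_insertNth hf a)

end Fubini

theorem schwingerWeightProd_insertNth {q : ℕ} (ν : Fin (q + 1) → ℤ) (a : Fin (q + 1)) (s : ℝ)
    (y : Fin q → ℝ) :
    schwingerWeightProd ν (a.insertNth s y) =
      schwingerWeight (ν a) s * schwingerWeightProd (fun j => ν (a.succAbove j)) y := by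
  simp [schwingerWeightProd, Fin.prod_univ_succAbove _ a]

theorem SchwingerIntegrable.ae_section {q : ℕ} {ν : Fin (q + 1) → ℤ}
    {g : (Fin (q + 1) → ℝ) → ℂ} (hg : SchwingerIntegrable ν g) (a : Fin (q + 1)) :
    ∀ᵐ y ∂schwingerMeasurePi fun j => ν (a.succAbove j),
      schwingerWeightProd (fun j => ν (a.succAbove j)) y ≠ 0 →
        Integrable (fun s => schwingerWeight (ν a) s * g (a.insertNth s y))
          (schwingerMeasure (ν a)) := by
  filter_upwards [(integrable_comp_insertNth hg a).prod_left_ae] with y hy hne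
  simp only [schwingerWeightProd_insertNth] at hy
  exact (integrable_mul_const_iff hne.isUnit _).1
    (hy.congr (Filter.Eventually.of_forall fun s => mul_right_comm _ _ _))

theorem schwingerIntegral_eq_integral_section {q : ℕ} {ν : Fin (q + 1) → ℤ}
    {g : (Fin (q + 1) → ℝ) → ℂ} (hg : SchwingerIntegrable ν g) (a : Fin (q + 1)) :
    schwingerIntegral ν g = ∫ y, schwingerWeightProd (fun j => ν (a.succAbove j)) y *
      ∫ s, schwingerWeight (ν a) s * g (a.insertNth s y) ∂schwingerMeasure (ν a)
        ∂schwingerMeasurePi fun j => ν (a.succAbove j) := by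
  rw [schwingerIntegral, integral_pi_eq_integral_insertNth hg a]
  simp only [schwingerWeightProd_insertNth, ← integral_const_mul]
  congr! 4 with y
  ring

theorem schwingerIntegral_sub_single {ν : Fin p → ℤ} {a : Fin p} (ha : 0 < ν a)
    {g g' : (Fin p → ℝ) → ℂ}
    (hg : ∀ α, HasDerivAt (fun s => g (Function.update α a s)) (-Complex.I * g' α) (α a))
    (hint : SchwingerIntegrable ν g) (hint' : SchwingerIntegrable ν g')
    (hlow : SchwingerIntegrable (ν - Pi.single a 1) g) :
    schwingerIntegral ν g' = schwingerIntegral (ν - Pi.single a 1) g := by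
  obtain ⟨q, rfl⟩ : ∃ q, p = q + 1 := ⟨p - 1, by have := a.2; omega⟩
  have others (j : Fin q) : (ν - Pi.single a 1 : Fin (q + 1) → ℤ) (a.succAbove j) =
      ν (a.succAbove j) := by simp
  have lowered : (ν - Pi.single a 1 : Fin (q + 1) → ℤ) a = ν a - 1 := by simp
  have hlow' := hlow.ae_section a
  rw [schwingerIntegral_eq_integral_section hint' a, schwingerIntegral_eq_integral_section hlow a]
  simp only [others, lowered] at hlow' ⊢
  refine integral_congr_ae ?_
  filter_upwards [hint.ae_section a, hint'.ae_section a, hlow'] with y hy hy' hylow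
  by_cases hne : schwingerWeightProd (fun j => ν (a.succAbove j)) y = 0
  · simp only [hne, zero_mul]
  · have deriv (s : ℝ) : HasDerivAt (fun s => g (a.insertNth s y))
        (-Complex.I * g' (a.insertNth s y)) s := by
      simpa using hg (a.insertNth s y)
    rw [integral_schwingerWeight_mul_deriv ha deriv (hy hne) (hy' hne) (hylow hne)]

end SchwingerIntegral

/-! ### Schwinger integrals of formal sums -/

section SchwingerFunctional

open MeasureTheory

variable {U V : MvPolynomial (Fin p) ℂ} {δ : ℝ}

theorem IsDamped.schwingerIntegrable_realize (h : IsDamped U V δ) (hδ : 0 < δ) (ν : Fin p → ℤ)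
    {f : GaussSum p} (hf : f ∈ regular p 0) : SchwingerIntegrable ν (realize U V f) := by
  rw [SchwingerIntegrable]
  simp only [realize_apply, Finset.mul_sum]
  refine integrable_finsetSum _ fun z hz => ?_
  have hz : 2 * ((0 : ℕ) : ℝ) < z.re := hf hz
  obtain ⟨C, k, hC⟩ := h.exists_norm_gaussTerm_le (z := z) (by simpa using hz.le) (f z)
  exact schwingerIntegrable_of_norm_le hδ ν (measurable_gaussTerm U V z _) hC

/-- The Schwinger parametrisation with exponents `ν` of a formal sum of functions of Gaussian
type. -/
def schwingerFunctional (U V : MvPolynomial (Fin p) ℂ) (ν : Fin p → ℤ) (f : GaussSum p) : ℂ :=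
  schwingerIntegral ν (realize U V (insertNumeratorFormal U V ν f))

namespace IsDamped

theorem schwingerIntegrable_insertNumeratorFormal (h : IsDamped U V δ) (hδ : 0 < δ)
    {ν : Fin p → ℤ} (ν' : Fin p → ℤ) {f : GaussSum p} (hf : f ∈ regular p (numeratorDegree ν)) :
    SchwingerIntegrable ν' (realize U V (insertNumeratorFormal U V ν f)) :=
  h.schwingerIntegrable_realize hδ ν' (insertNumeratorFormal_mem_regular (by rwa [zero_add]))

theorem exists_dual_eq_schwingerFunctional (h : IsDamped U V δ) (hδ : 0 < δ) (ν : Fin p → ℤ) :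
    ∃ Λ : Module.Dual ℂ (GaussSum p), ∀ f ∈ regular p (numeratorDegree ν),
      Λ f = schwingerFunctional U V ν f := by
  let Λ₀ : regular p (numeratorDegree ν) →ₗ[ℂ] ℂ :=
    { toFun f := schwingerFunctional U V ν f
      map_add' f g := by
        simp only [schwingerFunctional, schwingerIntegral, Submodule.coe_add, map_add, Pi.add_apply,
          mul_add]
        exact integral_add (h.schwingerIntegrable_insertNumeratorFormal hδ ν f.2)
          (h.schwingerIntegrable_insertNumeratorFormal hδ ν g.2)
      map_smul' c f := by
        simp only [schwingerFunctional, schwingerIntegral, Submodule.coe_smul, map_smul,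
          Pi.smul_apply, smul_eq_mul, mul_left_comm _ c, integral_const_mul, RingHom.id_apply] }
  obtain ⟨Λ, hΛ⟩ := Λ₀.exists_extend
  exact ⟨Λ, fun f hf => LinearMap.congr_fun hΛ ⟨f, hf⟩⟩

theorem schwingerFunctional_eq_zero (h : IsDamped U V δ) {ν : Fin p → ℤ} {f : GaussSum p}
    (hf : f ∈ regular p (numeratorDegree ν)) (hzero : realize U V f = 0) :
    schwingerFunctional U V ν f = 0 := by
  have numerator_zero := h.insertNumerator_realize (ν := ν) (zero_mem _)
  rw [map_zero, map_zero, map_zero] at numerator_zero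
  rw [schwingerFunctional, ← h.insertNumerator_realize hf, hzero, numerator_zero]
  simp [schwingerIntegral]

end IsDamped

theorem schwingerIntegral_congr_of_nonpos {ν ν' : Fin p → ℤ} {a : Fin p} (ha : ν a ≤ 0)
    (ha' : ν' a ≤ 0) (h : ∀ b ≠ a, ν b = ν' b) (g : (Fin p → ℝ) → ℂ) :
    schwingerIntegral ν g = schwingerIntegral ν' g := by
  have measure_eq : schwingerMeasurePi ν = schwingerMeasurePi ν' := by
    refine congrArg Measure.pi (funext fun b => ?_)
    rcases eq_or_ne b a with rfl | hb
    · rw [schwingerMeasure_of_nonpos ha, schwingerMeasure_of_nonpos ha']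
    · rw [h b hb]
  have weight_eq : schwingerWeightProd ν = schwingerWeightProd ν' := by
    refine funext fun α => Finset.prod_congr rfl fun b _ => ?_
    rcases eq_or_ne b a with rfl | hb
    · rw [schwingerWeight_of_nonpos ha, schwingerWeight_of_nonpos ha']
    · rw [h b hb]
  rw [schwingerIntegral, schwingerIntegral, measure_eq, weight_eq]

theorem ae_schwingerMeasurePi_eq_zero {ν : Fin p → ℤ} {a : Fin p} (ha : ν a ≤ 0) :
    ∀ᵐ α ∂schwingerMeasurePi ν, α a = 0 := by
  refine (Measure.quasiMeasurePreserving_eval _ a).ae (p := fun s => s = 0) ?_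
  rw [schwingerMeasure_of_nonpos ha]
  exact (ae_dirac_iff (measurableSet_singleton 0)).2 rfl

theorem schwingerIntegral_mul_param_of_pos {ν : Fin p → ℤ} {a : Fin p} (ha : 0 < ν a)
    (g : (Fin p → ℝ) → ℂ) :
    schwingerIntegral ν (fun α => α a * g α) =
      -Complex.I * ν a * schwingerIntegral (ν + Pi.single a 1) g := by
  have measure_eq : schwingerMeasurePi (ν + Pi.single a 1) = schwingerMeasurePi ν := by
    refine congrArg Measure.pi (funext fun b => ?_)
    rcases eq_or_ne b a with rfl | hb
    · rw [schwingerMeasure_of_pos ha, schwingerMeasure_of_pos (by simp; omega)]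
    · simp [hb]
  have weight_eq (α : Fin p → ℝ) : schwingerWeightProd ν α * α a =
      -Complex.I * ν a * schwingerWeightProd (ν + Pi.single a 1) α := by
    rw [schwingerWeightProd, schwingerWeightProd, ← Finset.mul_prod_erase _ _ (Finset.mem_univ a),
      ← Finset.mul_prod_erase _ _ (Finset.mem_univ a), mul_right_comm, schwingerWeight_mul_self ha,
      ← mul_assoc]
    congr 1
    · simp
    · exact Finset.prod_congr rfl fun b hb => by simp [Finset.ne_of_mem_erase hb]
  rw [schwingerIntegral, schwingerIntegral, measure_eq, ← integral_const_mul]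
  exact integral_congr_ae (.of_forall fun α => by
    simp only [← mul_assoc, weight_eq])

theorem schwingerFunctional_mulParam (ν : Fin p → ℤ) (a : Fin p) (f : GaussSum p) :
    schwingerFunctional U V ν (mulParam a f) =
      -Complex.I * ν a * schwingerFunctional U V (ν + Pi.single a 1) f := by
  rw [schwingerFunctional, schwingerFunctional, ← Module.End.mul_apply,
    insertNumeratorFormal_mul_mulParam]
  rcases le_or_gt (ν a) 0 with ha | ha
  · have at_zero : schwingerIntegral ν (realize U V ((mulParam a * insertNumeratorFormal U V ν +
        (Complex.I * (-ν a).toNat) •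
          (lowerExponent U * insertNumeratorFormal U V (ν + Pi.single a 1))) f)) =
        -Complex.I * ν a *
          schwingerIntegral ν (realize U V (insertNumeratorFormal U V (ν + Pi.single a 1) f)) := by
      rw [schwingerIntegral, schwingerIntegral, ← integral_const_mul]
      refine integral_congr_ae ?_
      filter_upwards [ae_schwingerMeasurePi_eq_zero ha] with α hα
      have hcast : ((-ν a).toNat : ℂ) = -ν a := by exact_mod_cast Int.toNat_of_nonneg (by omega)
      simp only [LinearMap.add_apply, LinearMap.smul_apply, Module.End.mul_apply, map_add, map_smul,
        Pi.add_apply, Pi.smul_apply, realize_mulParam, realize_lowerExponent, hα, hcast,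
        smul_eq_mul]
      push_cast
      ring
    rw [at_zero]
    obtain hzero | hneg : ν a = 0 ∨ ν a < 0 := by omega
    · simp [hzero]
    · rw [schwingerIntegral_congr_of_nonpos ha (ν' := ν + Pi.single a 1) (by simp; omega)
        (by simp +contextual)]
  · rw [Int.toNat_of_nonpos (by omega), Nat.cast_zero, mul_zero, zero_smul, add_zero,
      Module.End.mul_apply, funext (realize_mulParam a _), schwingerIntegral_mul_param_of_pos ha,
      insertNumeratorFormal_congr_of_pos (ν' := ν + Pi.single a 1) ha.le (by simp; omega)
        (by simp +contextual)]

namespace IsDamped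

theorem schwingerFunctional_insertFormal (h : IsDamped U V δ) (hδ : 0 < δ) {ν : Fin p → ℤ}
    {f : GaussSum p} (hf : f ∈ regular p (numeratorDegree ν + 1)) (a : Fin p) :
    schwingerFunctional U V ν (insertFormal U V a f) =
      schwingerFunctional U V (ν - Pi.single a 1) f := by
  have others (b : Fin p) (hb : b ≠ a) : (ν - Pi.single a 1 : Fin p → ℤ) b = ν b := by simp [hb]
  rw [schwingerFunctional, schwingerFunctional]
  rcases le_or_gt (ν a) 0 with ha | ha
  · rw [insertNumeratorFormal_lower ha, Module.End.mul_apply]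
    exact schwingerIntegral_congr_of_nonpos ha (by simp; omega) (fun b hb => (others b hb).symm) _
  · have hf' := regular_anti (Nat.le_add_right _ 1) hf
    rw [insertNumeratorFormal_congr_of_pos (ν' := ν) (by simp; omega) ha.le others,
      ← Module.End.mul_apply, ← (commute_insertFormal_insertNumeratorFormal ν a).eq,
      Module.End.mul_apply]
    have hreg : insertNumeratorFormal U V ν f ∈ regular p 1 :=
      insertNumeratorFormal_mem_regular (by rwa [add_comm])
    exact schwingerIntegral_sub_single ha (h.hasDerivAt_realize hreg a)
      (h.schwingerIntegrable_insertNumeratorFormal hδ ν hf')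
      (h.schwingerIntegrable_realize hδ ν (insertFormal_mem_regular hreg a))
      (h.schwingerIntegrable_insertNumeratorFormal hδ _ hf')

end IsDamped

end SchwingerFunctional

section Parametrisation

open MeasureTheory

variable {U V : MvPolynomial (Fin p) ℂ} {δ : ℝ}

theorem measurePreserving_extendZero (ν : Fin p → ℤ) :
    MeasurePreserving (extendZero ν) (volume.restrict (orthant ν)) (schwingerMeasurePi ν) := by
  have split := (measurePreserving_piEquivPiSubtypeProd (fun a => schwingerMeasure (ν a))
    (fun a => 0 < ν a)).symm
  have positive : (Measure.pi fun a : {a // 0 < ν a} => schwingerMeasure (ν a)) =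
      volume.restrict (orthant ν) := by
    have : orthant ν = Set.univ.pi fun _ => Set.Ioi 0 := by ext; simp [orthant]
    rw [this, volume_pi, Measure.restrict_pi_pi]
    exact congrArg _ (funext fun a => schwingerMeasure_of_pos a.2)
  have nonpositive : (Measure.pi fun a : {a // ¬ 0 < ν a} => schwingerMeasure (ν a)) =
      Measure.dirac 0 := by
    rw [← Measure.infinitePi_dirac 0, Measure.infinitePi_eq_pi]
    exact congrArg _ (funext fun a => schwingerMeasure_of_nonpos (not_lt.1 a.2))
  rw [positive, nonpositive, Measure.prod_dirac] at split
  exact split.comp (Measurable.measurePreserving (by fun_prop) _)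

theorem Family.schwingerIntegrand_eq_comp_extendZero (F : Family L n p) (x : Scale n p → ℂ)
    (ν : Fin p → ℤ) (D : ℂ) :
    F.schwingerIntegrand x ν D = (fun α => schwingerWeightProd ν α *
      insertNumerator ν (F.gaussian x D) α) ∘ extendZero ν := by
  funext α
  rw [Family.schwingerIntegrand, Function.comp_apply, schwingerWeightProd,
    ← Fintype.prod_subtype_mul_prod_subtype (fun a => 0 < ν a)
      (fun a => schwingerWeight (ν a) (extendZero ν α a)),
    Finset.prod_eq_one (s := (Finset.univ : Finset {a // ¬ 0 < ν a}))
      (fun a _ => schwingerWeight_of_nonpos (not_lt.1 a.2) _), mul_one]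
  congr 1
  refine Finset.prod_congr rfl fun a _ => ?_
  simp [schwingerWeight, extendZero, a.2]

theorem Family.integrableOn_schwingerIntegrand {F : Family L n p} {x : Scale n p → ℂ}
    {ν : Fin p → ℤ} {D : ℂ}
    (hg : SchwingerIntegrable ν (insertNumerator ν (F.gaussian x D))) :
    IntegrableOn (F.schwingerIntegrand x ν D) (orthant ν) := by
  rw [F.schwingerIntegrand_eq_comp_extendZero]
  exact ((measurePreserving_extendZero ν).integrable_comp hg.aestronglyMeasurable).2 hg

theorem Family.integral_schwingerIntegrand {F : Family L n p} {x : Scale n p → ℂ}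
    {ν : Fin p → ℤ} {D : ℂ}
    (hg : SchwingerIntegrable ν (insertNumerator ν (F.gaussian x D))) :
    ∫ α in orthant ν, F.schwingerIntegrand x ν D α =
      schwingerIntegral ν (insertNumerator ν (F.gaussian x D)) := by
  have mp := measurePreserving_extendZero ν
  rw [F.schwingerIntegrand_eq_comp_extendZero, schwingerIntegral, ← mp.map_eq,
    integral_map mp.measurable.aemeasurable (mp.map_eq ▸ hg.aestronglyMeasurable)]
  rfl

end Parametrisation

/-! ### Schur complements -/

section SchurComplement

open Matrix

variable {ι κ R : Type*} [Fintype ι] [DecidableEq ι] [CommRing R]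

/-- The Schur complement of the upper left block. For the matrix of a quadratic form on a sum of two
spaces it is the form on the second space that remains after stationarity in the first. -/
def schurComplement (M : Matrix (ι ⊕ κ) (ι ⊕ κ) R) : Matrix κ κ R :=
  M.toBlocks₂₂ - M.toBlocks₂₁ * M.toBlocks₁₁⁻¹ * M.toBlocks₁₂

/-- The numerator of the Schur complement, which is polynomial in the entries of the matrix. -/
def schurNumerator (M : Matrix (ι ⊕ κ) (ι ⊕ κ) R) : Matrix κ κ R :=
  M.toBlocks₁₁.det • M.toBlocks₂₂ - M.toBlocks₂₁ * M.toBlocks₁₁.adjugate * M.toBlocks₁₂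

/-- The map from the second space to the points at which the quadratic form is stationary in the
first space. -/
def schurLift [DecidableEq κ] (M : Matrix (ι ⊕ κ) (ι ⊕ κ) R) : Matrix (ι ⊕ κ) κ R :=
  fromRows (-(M.toBlocks₁₁⁻¹ * M.toBlocks₁₂)) 1

theorem schurNumerator_map {S : Type*} [CommRing S] (f : R →+* S)
    (M : Matrix (ι ⊕ κ) (ι ⊕ κ) R) : schurNumerator (M.map f) = (schurNumerator M).map f := by
  have adjugate_map : (M.map f).toBlocks₁₁.adjugate = M.toBlocks₁₁.adjugate.map f :=
    (f.map_adjugate M.toBlocks₁₁).symm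
  have det_map : (M.map f).toBlocks₁₁.det = f M.toBlocks₁₁.det := (f.map_det M.toBlocks₁₁).symm
  ext i j
  simp [schurNumerator, adjugate_map, det_map, mul_apply, toBlocks₁₂, toBlocks₂₁, toBlocks₂₂]

theorem schurNumerator_eq_smul {M : Matrix (ι ⊕ κ) (ι ⊕ κ) R} (hM : IsUnit M.toBlocks₁₁.det) :
    schurNumerator M = M.toBlocks₁₁.det • schurComplement M := by
  have adjugate_eq : M.toBlocks₁₁.adjugate = M.toBlocks₁₁.det • M.toBlocks₁₁⁻¹ := by
    rw [inv_def, smul_smul, Ring.mul_inverse_cancel _ hM, one_smul]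
  rw [schurNumerator, schurComplement, adjugate_eq, smul_sub, Matrix.mul_smul, Matrix.smul_mul]

theorem transpose_schurComplement (M : Matrix (ι ⊕ κ) (ι ⊕ κ) R) :
    (schurComplement M)ᵀ = schurComplement Mᵀ := by
  have transpose_inv : Mᵀ.toBlocks₁₁⁻¹ = M.toBlocks₁₁⁻¹ᵀ := (transpose_nonsing_inv _).symm
  rw [schurComplement, schurComplement, transpose_inv, transpose_sub, transpose_mul, transpose_mul,
    Matrix.mul_assoc]
  rfl

section Lift

variable [Fintype κ] [DecidableEq κ]

theorem mul_schurLift {M : Matrix (ι ⊕ κ) (ι ⊕ κ) R} (hM : IsUnit M.toBlocks₁₁.det) :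
    M * schurLift M = fromRows 0 (schurComplement M) := by
  conv_lhs => rw [← fromBlocks_toBlocks M]
  rw [schurLift, fromBlocks_mul_fromRows, toBlocks_fromBlocks₁₁, toBlocks_fromBlocks₁₂]
  congr 1
  · rw [Matrix.mul_neg, mul_nonsing_inv_cancel_left _ _ hM, Matrix.mul_one, neg_add_cancel]
  · rw [schurComplement, Matrix.mul_neg, Matrix.mul_one, neg_add_eq_sub, Matrix.mul_assoc]

theorem schurComplement_sub_schurComplement {M N : Matrix (ι ⊕ κ) (ι ⊕ κ) R} (hsymm : M.IsSymm)
    (hM : IsUnit M.toBlocks₁₁.det) (hN : IsUnit N.toBlocks₁₁.det) :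
    schurComplement N - schurComplement M = (schurLift M)ᵀ * (N - M) * schurLift N := by
  have transpose_mul_self : (schurLift M)ᵀ * M = fromCols 0 (schurComplement M) := by
    have := congrArg transpose (mul_schurLift hM)
    rwa [transpose_mul, hsymm.eq, transpose_fromRows, transpose_zero, transpose_schurComplement,
      hsymm.eq] at this
  rw [Matrix.mul_sub, Matrix.sub_mul, Matrix.mul_assoc, mul_schurLift hN, transpose_mul_self]
  simp [schurLift, transpose_fromRows, fromCols_mul_fromRows]

end Lift

section Derivative

theorem hasDerivAt_det_add_smul {𝕜 : Type*} [NontriviallyNormedField 𝕜] {A : Matrix ι ι 𝕜}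
    (hA : IsUnit A.det) (B : Matrix ι ι 𝕜) :
    HasDerivAt (fun z : 𝕜 => (A + z • B).det) (A.det * (A⁻¹ * B).trace) 0 := by
  have expand (z : 𝕜) : (A + z • B).det = A.det * (1 + (A⁻¹ * B).trace * z +
      (det (1 + (Polynomial.X : Polynomial 𝕜) • (A⁻¹ * B).map Polynomial.C)).divX.divX.eval z *
        z ^ 2) := by
    rw [← det_one_add_smul, ← det_mul, mul_add, Matrix.mul_one, Matrix.mul_smul,
      mul_nonsing_inv_cancel_left _ _ hA]
  simp only [expand]
  refine ((((hasDerivAt_id (0 : 𝕜)).const_mul _).const_add 1).fun_add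
    ((Polynomial.hasDerivAt _ (0 : 𝕜)).fun_mul (hasDerivAt_pow 2 (0 : 𝕜)))).const_mul A.det
    |>.congr_deriv ?_
  simp

variable {𝕜 : Type*} [NontriviallyNormedField 𝕜] [DecidableEq κ]

theorem continuousAt_schurLift {M : Matrix (ι ⊕ κ) (ι ⊕ κ) 𝕜} (hM : IsUnit M.toBlocks₁₁.det) :
    ContinuousAt schurLift M := by
  have inv : ContinuousAt (fun M : Matrix (ι ⊕ κ) (ι ⊕ κ) 𝕜 => M.toBlocks₁₁⁻¹) M := by
    refine ContinuousAt.comp (f := fun M : Matrix (ι ⊕ κ) (ι ⊕ κ) 𝕜 => M.toBlocks₁₁)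
      (continuousAt_matrix_inv _ ?_)
      (continuous_id.matrix_submatrix Sum.inl Sum.inl).continuousAt
    rw [Ring.inverse_eq_inv']
    exact continuousAt_inv₀ hM.ne_zero
  refine continuousAt_pi.2 fun t => continuousAt_pi.2 fun j => ?_
  rcases t with i | i
  · have inv_elem (k : ι) : ContinuousAt
        (fun M : Matrix (ι ⊕ κ) (ι ⊕ κ) 𝕜 => M.toBlocks₁₁⁻¹ i k) M :=
      continuousAt_pi.1 (continuousAt_pi.1 inv i) k
    have elem (k : ι) : ContinuousAt (fun M : Matrix (ι ⊕ κ) (ι ⊕ κ) 𝕜 => M.toBlocks₁₂ k j) M :=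
      (continuous_id.matrix_elem (Sum.inl k) (Sum.inr j)).continuousAt
    simp only [schurLift, fromRows_apply_inl]
    exact (tendsto_finsetSum _ fun k _ => (inv_elem k).mul (elem k)).neg
  · simpa only [schurLift, fromRows_apply_inr] using continuousAt_const

theorem hasDerivAt_trace_schurComplement_mul [Fintype κ] {M : Matrix (ι ⊕ κ) (ι ⊕ κ) 𝕜}
    (hsymm : M.IsSymm) (hM : IsUnit M.toBlocks₁₁.det) (N : Matrix (ι ⊕ κ) (ι ⊕ κ) 𝕜)
    (X : Matrix κ κ 𝕜) :
    HasDerivAt (fun z : 𝕜 => (schurComplement (M + z • N) * X).trace)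
      (N * (schurLift M * X * (schurLift M)ᵀ)).trace 0 := by
  have line : Continuous fun z : 𝕜 => M + z • N := by fun_prop
  have isUnit : ∀ᶠ z in 𝓝 (0 : 𝕜), IsUnit (M + z • N).toBlocks₁₁.det := by
    have det : Continuous fun z : 𝕜 => (M + z • N).toBlocks₁₁.det :=
      (line.matrix_submatrix Sum.inl Sum.inl).matrix_det
    simpa using det.continuousAt.eventually_ne (by simpa using hM.ne_zero)
  have slope : ∀ᶠ z in 𝓝[≠] (0 : 𝕜), ((schurLift M)ᵀ * N * schurLift (M + z • N) * X).trace =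
      z⁻¹ • ((schurComplement (M + (0 + z) • N) * X).trace -
        (schurComplement (M + (0 : 𝕜) • N) * X).trace) := by
    filter_upwards [self_mem_nhdsWithin, nhdsWithin_le_nhds isUnit] with z hz hunit
    rw [zero_add, zero_smul, add_zero, ← trace_sub, ← Matrix.sub_mul,
      schurComplement_sub_schurComplement hsymm hM hunit, add_sub_cancel_left, Matrix.mul_smul,
      Matrix.smul_mul, Matrix.smul_mul, trace_smul, smul_smul, inv_mul_cancel₀ hz, one_smul]
  have continuousAt : ContinuousAt (fun z : 𝕜 =>
      ((schurLift M)ᵀ * N * schurLift (M + z • N) * X).trace) 0 := by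
    have mul : Continuous fun T : Matrix (ι ⊕ κ) κ 𝕜 => ((schurLift M)ᵀ * N * T * X).trace :=
      ((continuous_const.matrix_mul continuous_id).matrix_mul continuous_const).matrix_trace
    refine mul.continuousAt.comp (ContinuousAt.comp (g := schurLift) ?_ line.continuousAt)
    simpa using continuousAt_schurLift hM
  have value : (N * (schurLift M * X * (schurLift M)ᵀ)).trace =
      ((schurLift M)ᵀ * N * schurLift (M + (0 : 𝕜) • N) * X).trace := by
    rw [zero_smul, add_zero, ← Matrix.mul_assoc, trace_mul_comm]
    simp only [Matrix.mul_assoc]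
  rw [hasDerivAt_iff_tendsto_slope_zero, value]
  exact (continuousAt.tendsto.mono_left nhdsWithin_le_nhds).congr' slope

end Derivative

end SchurComplement

/-! ### The Symanzik polynomials -/

section Symanzik

open Matrix

variable {R S : Type*} [CommRing R] [CommRing S]

/-- The matrix of the quadratic form `∑ a, α_a q_a ^ 2` in all momenta, in the notation of the paper
with blocks `A`, `B`, `Bᵀ` and `C`. The parameters may be numbers or indeterminates. -/
def Family.quadMatrix (F : Family L n p) (α : Fin p → R) : Matrix (Mom L n) (Mom L n) R :=
  of fun t u => ∑ a, α a * ((F.coeff a t : R) * (F.coeff a u : R))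

/-- The Gram matrix of the external momenta. -/
def extGram {R : Type*} (x : Scale n p → R) : Matrix (Fin n) (Fin n) R :=
  of fun i j => x (Sum.inl s(i, j))

/-- The first Symanzik polynomial. -/
def Family.polyU (F : Family L n p) : MvPolynomial (Fin p) ℂ :=
  (F.quadMatrix MvPolynomial.X).toBlocks₁₁.det

/-- The second Symanzik polynomial. -/
def Family.polyF (F : Family L n p) (x : Scale n p → ℂ) : MvPolynomial (Fin p) ℂ :=
  F.polyU * ∑ a, MvPolynomial.C (x (Sum.inr a)) * MvPolynomial.X a -
    (schurNumerator (F.quadMatrix MvPolynomial.X) * (extGram x).map MvPolynomial.C).trace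

theorem Family.quadMatrix_isSymm (F : Family L n p) (α : Fin p → R) : (F.quadMatrix α).IsSymm := by
  ext t u
  simp only [quadMatrix, transpose_apply, of_apply, mul_comm (F.coeff _ t : R)]

theorem extGram_isSymm {R : Type*} (x : Scale n p → R) : (extGram x).IsSymm := by
  ext i j
  simp only [extGram, transpose_apply, of_apply, Sym2.eq_swap]

theorem Family.quadMatrix_map (F : Family L n p) (f : R →+* S) (α : Fin p → R) :
    (F.quadMatrix α).map f = F.quadMatrix fun a => f (α a) := by
  ext t u
  simp [quadMatrix]

theorem Family.quadMatrix_ofReal (F : Family L n p) (α : Fin p → ℝ) :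
    (F.quadMatrix fun a => (α a : ℂ)) = (F.quadMatrix α).map Complex.ofRealHom :=
  (F.quadMatrix_map Complex.ofRealHom α).symm

theorem Family.det_quadMatrix_ofReal (F : Family L n p) (α : Fin p → ℝ) :
    (F.quadMatrix fun a => (α a : ℂ)).toBlocks₁₁.det = F.symanzikU α := by
  rw [quadMatrix_ofReal]
  exact (Complex.ofRealHom.map_det _).symm

theorem Family.symanzikF_eq (F : Family L n p) (x : Scale n p → ℂ) (α : Fin p → ℝ) :
    F.symanzikF x α = F.symanzikU α * ∑ a, x (Sum.inr a) * (α a : ℂ) -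
      (schurNumerator (F.quadMatrix fun a => (α a : ℂ)) * extGram x).trace := by
  have lower : (F.mixedMatrix α)ᵀ = (F.quadMatrix α).toBlocks₂₁ :=
    congrArg toBlocks₂₁ (F.quadMatrix_isSymm α)
  rw [symanzikF, quadMatrix_ofReal, schurNumerator_map, lower, trace]
  simp only [diag_apply, mul_apply, (extGram_isSymm x).apply]
  rfl

theorem Family.ev_polyU (F : Family L n p) (α : Fin p → ℝ) : ev α F.polyU = F.symanzikU α := by
  rw [← det_quadMatrix_ofReal, polyU, RingHom.map_det]
  simp only [← ev_X α, ← F.quadMatrix_map (ev α)]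
  rfl

theorem Family.ev_polyF (F : Family L n p) (x : Scale n p → ℂ) (α : Fin p → ℝ) :
    ev α (F.polyF x) = F.symanzikF x α := by
  have trace_map : ev α (schurNumerator (F.quadMatrix MvPolynomial.X) *
      (extGram x).map MvPolynomial.C).trace =
      (schurNumerator (F.quadMatrix fun a => (α a : ℂ)) * extGram x).trace := by
    have gram_map : extGram x = ((extGram x).map MvPolynomial.C).map (ev α) := by
      ext i j
      simp
    simp only [← ev_X α, ← F.quadMatrix_map (ev α), schurNumerator_map]
    conv_rhs => rw [gram_map, ← Matrix.map_mul]
    exact AddMonoidHom.map_trace (ev α).toAddMonoidHom _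
  simp only [polyF, symanzikF_eq, map_sub, map_mul, ev_polyU, map_sum, ev_C, ev_X, trace_map]

theorem Family.gaussian_eq_realize (F : Family L n p) (x : Scale n p → ℂ) (D : ℂ) :
    F.gaussian x D = realize F.polyU (F.polyF x) (Finsupp.single (-D / 2) 1) := by
  ext α
  simp only [gaussian, realize_single, gaussTerm_apply, F.ev_polyU, F.ev_polyF, Complex.ofReal_re,
    map_one, one_mul]

theorem Family.symanzikF_shiftScales (F : Family L n p) (x : Scale n p → ℝ) (δ : ℝ)
    (α : Fin p → ℝ) : ∃ y : ℝ, F.symanzikF (shiftScales x δ) α =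
      y - Complex.I * (δ * ∑ a, α a : ℝ) * F.symanzikU α := by
  refine ⟨F.symanzikU α * ∑ a, x (Sum.inr a) * α a -
    (schurNumerator (F.quadMatrix α) * extGram x).trace, ?_⟩
  have trace_map : (schurNumerator (F.quadMatrix fun a => (α a : ℂ)) *
      extGram (shiftScales x δ)).trace = (schurNumerator (F.quadMatrix α) * extGram x).trace := by
    have gram_map : extGram (shiftScales x δ) = (extGram x).map Complex.ofRealHom := rfl
    rw [quadMatrix_ofReal, gram_map, schurNumerator_map, ← Matrix.map_mul]
    exact (AddMonoidHom.map_trace Complex.ofRealHom.toAddMonoidHom _).symm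
  rw [symanzikF_eq, trace_map]
  simp only [shiftScales, Sum.elim_inr, sub_mul, Finset.sum_sub_distrib, ← Finset.mul_sum]
  push_cast
  simp only [mul_assoc]
  ring

theorem Family.isDamped (F : Family L n p) (x : Scale n p → ℝ) (δ : ℝ) :
    IsDamped F.polyU (F.polyF (shiftScales x δ)) δ where
  im_eq α := by rw [F.ev_polyU, Complex.ofReal_im]
  norm_exp_le α hα := by
    rw [F.ev_polyU, Complex.ofReal_re] at hα
    obtain ⟨y, hy⟩ := F.symanzikF_shiftScales x δ α
    have exponent : -Complex.I * F.symanzikF (shiftScales x δ) α / F.symanzikU α =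
        (-δ * ∑ a, α a : ℝ) + (-(y / F.symanzikU α) : ℝ) * Complex.I := by
      have : (F.symanzikU α : ℂ) ≠ 0 := by exact_mod_cast hα.ne'
      rw [hy, div_eq_iff this]
      push_cast
      field_simp
      linear_combination ((δ : ℂ) * (∑ a, (α a : ℂ)) * F.symanzikU α) * Complex.I_sq
    rw [F.ev_polyU, F.ev_polyF, exponent, Complex.norm_exp]
    simp

end Symanzik

/-! ### Gaussian expectation values -/

section Moments

open Matrix

variable {ι κ R : Type*} [Fintype ι] [DecidableEq ι] [Fintype κ] [DecidableEq κ]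
  [CommRing R]

/-- The second moments of a Gaussian distribution of the first variables `k` for fixed second
variables `p` with Gram matrix `X`, where `M` is the matrix of the exponent and `c` is a scale: the
mean of `k` is linear in `p` and its covariance is `c` times the inverse of the upper left block. -/
def gaussMoment (M : Matrix (ι ⊕ κ) (ι ⊕ κ) R) (X : Matrix κ κ R) (c : R) :
    Matrix (ι ⊕ κ) (ι ⊕ κ) R :=
  schurLift M * X * (schurLift M)ᵀ + c • fromBlocks M.toBlocks₁₁⁻¹ 0 0 0

theorem gaussMoment_isSymm {M : Matrix (ι ⊕ κ) (ι ⊕ κ) R} (hM : M.IsSymm) {X : Matrix κ κ R}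
    (hX : X.IsSymm) (c : R) : (gaussMoment M X c).IsSymm := by
  have inv : (M.toBlocks₁₁⁻¹)ᵀ = M.toBlocks₁₁⁻¹ := by
    rw [transpose_nonsing_inv]
    exact congrArg (fun N : Matrix (ι ⊕ κ) (ι ⊕ κ) R => N.toBlocks₁₁⁻¹) hM
  rw [IsSymm, gaussMoment, transpose_add, transpose_smul, fromBlocks_transpose, inv,
    transpose_mul, transpose_mul, transpose_transpose, hX.eq, Matrix.mul_assoc]
  simp only [transpose_zero]

theorem gaussMoment_inr_inr (M : Matrix (ι ⊕ κ) (ι ⊕ κ) R) (X : Matrix κ κ R) (c : R) (j k : κ) :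
    gaussMoment M X c (Sum.inr j) (Sum.inr k) = X j k := by
  simp [gaussMoment, schurLift, transpose_fromRows, fromRows_mul]

theorem trace_mul_gaussMoment (N M : Matrix (ι ⊕ κ) (ι ⊕ κ) R) (X : Matrix κ κ R) (c : R) :
    (N * gaussMoment M X c).trace = (N * (schurLift M * X * (schurLift M)ᵀ)).trace +
      c * (M.toBlocks₁₁⁻¹ * N.toBlocks₁₁).trace := by
  rw [gaussMoment, mul_add, trace_add, Matrix.mul_smul, trace_smul, smul_eq_mul]
  refine congrArg (_ + c * ·) ?_
  rw [trace_mul_comm]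
  conv_lhs => rw [← fromBlocks_toBlocks N, fromBlocks_multiply]
  simp [trace, Fintype.sum_sum_type]

/- Stationarity of the mean removes its contribution. -/
theorem mul_gaussMoment_inl {M : Matrix (ι ⊕ κ) (ι ⊕ κ) R} (hM : IsUnit M.toBlocks₁₁.det)
    (X : Matrix κ κ R) (c : R) (i : ι) (t : ι ⊕ κ) :
    (M * gaussMoment M X c) (Sum.inl i) t = if t = Sum.inl i then c else 0 := by
  have mean : M * (schurLift M * X * (schurLift M)ᵀ) =
      fromRows 0 (schurComplement M * X * (schurLift M)ᵀ) := by
    rw [← Matrix.mul_assoc, ← Matrix.mul_assoc, mul_schurLift hM]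
    simp [fromRows_mul]
  have cov : M * fromBlocks M.toBlocks₁₁⁻¹ 0 0 0 =
      fromBlocks 1 0 (M.toBlocks₂₁ * M.toBlocks₁₁⁻¹) 0 := by
    conv_lhs => rw [← fromBlocks_toBlocks M]
    simp [fromBlocks_multiply, mul_nonsing_inv _ hM]
  rw [gaussMoment, mul_add, mean, Matrix.mul_smul, cov]
  rcases t with t | t <;> simp [one_apply, eq_comm]

end Moments

section Wick

open Matrix

/-- The coefficients of the momenta in the momentum of propagator `b`. -/
def Family.propVec (F : Family L n p) (b : Fin p) (t : Mom L n) : ℂ := F.coeff b t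

/-- The expectation values of dot products of momenta in the Gaussian integral over the loop momenta
in dimension `D` with Schwinger parameters `α`. -/
def Family.gaussMean (F : Family L n p) (x : Scale n p → ℂ) (D : ℂ) (α : Fin p → ℝ) :
    Sym2 (Mom L n) → ℂ :=
  Sym2.lift ⟨gaussMoment (F.quadMatrix fun a => (α a : ℂ)) (extGram x)
    (Complex.I * D / 2),
    fun t u => ((gaussMoment_isSymm (F.quadMatrix_isSymm _) (extGram_isSymm x) _).apply t u).symm⟩

theorem Family.gaussMean_inr (F : Family L n p) (x : Scale n p → ℂ) (D : ℂ) (α : Fin p → ℝ)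
    (e : Sym2 (Fin n)) : F.gaussMean x D α (Sym2.map Sum.inr e) = x (Sum.inl e) := by
  induction e with
  | _ j k => exact gaussMoment_inr_inr _ _ _ j k

theorem Family.invPropValue_gaussMean (F : Family L n p) (x : Scale n p → ℂ) (D : ℂ)
    (α : Fin p → ℝ) (m : Fin p → ℂ) (b : Fin p) :
    F.invPropValue (F.gaussMean x D α) m b = m b - (vecMulVec (F.propVec b) (F.propVec b) *
      gaussMoment (F.quadMatrix fun a => (α a : ℂ)) (extGram x) (Complex.I * D / 2)).trace := by
  simp only [invPropValue, trace, diag_apply, mul_apply, vecMulVec_apply,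
    (gaussMoment_isSymm (F.quadMatrix_isSymm _) (extGram_isSymm x) _).apply]
  rfl

theorem Family.sum_param_mul_gaussMean (F : Family L n p) (x : Scale n p → ℂ) (D : ℂ)
    {α : Fin p → ℝ} (hU : F.symanzikU α ≠ 0) (i : Fin L) (t : Mom L n) :
    ∑ a, ∑ u, (α a : ℂ) * F.coeff a (Sum.inl i) * F.coeff a u * F.gaussMean x D α s(t, u) =
      if t = Sum.inl i then Complex.I * D / 2 else 0 := by
  have isUnit : IsUnit (F.quadMatrix fun a => (α a : ℂ)).toBlocks₁₁.det := by
    simpa [det_quadMatrix_ofReal] using hU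
  rw [← mul_gaussMoment_inl isUnit (extGram x), mul_apply, Finset.sum_comm]
  refine Finset.sum_congr rfl fun u _ => ?_
  rw [Sym2.eq_swap, quadMatrix, of_apply, Finset.sum_mul]
  refine Finset.sum_congr rfl fun a _ => ?_
  rw [← mul_assoc (α a : ℂ)]
  rfl

theorem Family.quadMatrix_update (F : Family L n p) (α : Fin p → ℝ) (b : Fin p) (s : ℝ) :
    (F.quadMatrix fun a => (Function.update α b s a : ℂ)) =
      (F.quadMatrix fun a => (α a : ℂ)) +
        ((s - α b : ℝ) : ℂ) • vecMulVec (F.propVec b) (F.propVec b) := by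
  have update_eq (a : Fin p) : ((Function.update α b s a : ℝ) : ℂ) =
      α a + if a = b then ((s - α b : ℝ) : ℂ) else 0 := by
    rcases eq_or_ne a b with rfl | h <;> simp [*]
  ext t u
  simp only [update_eq, quadMatrix, of_apply, add_mul, Finset.sum_add_distrib, Matrix.add_apply,
    Matrix.smul_apply, vecMulVec_apply, smul_eq_mul, propVec, ite_mul, zero_mul,
    Finset.sum_ite_eq', Finset.mem_univ, if_true]

theorem Family.symanzikF_div (F : Family L n p) (x : Scale n p → ℂ) {α : Fin p → ℝ}
    (hU : F.symanzikU α ≠ 0) : F.symanzikF x α / F.symanzikU α =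
      ∑ a, x (Sum.inr a) * α a -
        (schurComplement (F.quadMatrix fun a => (α a : ℂ)) * extGram x).trace := by
  have isUnit : IsUnit (F.quadMatrix fun a => (α a : ℂ)).toBlocks₁₁.det := by
    simpa [det_quadMatrix_ofReal] using hU
  rw [symanzikF_eq, schurNumerator_eq_smul isUnit, det_quadMatrix_ofReal, Matrix.smul_mul,
    trace_smul, smul_eq_mul, ← mul_sub, mul_div_cancel_left₀ _ (by exact_mod_cast hU)]

theorem hasDerivAt_comp_sub_ofReal {f : ℂ → ℂ} {f' : ℂ} (hf : HasDerivAt f f' 0) (s : ℝ) :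
    HasDerivAt (fun y : ℝ => f ((y - s : ℝ) : ℂ)) f' s := by
  have hf : HasDerivAt f f' ((s - s : ℝ) : ℂ) := by simpa using hf
  exact hf.comp_ofReal.comp_sub_const s s

theorem Family.hasDerivAt_symanzikU_update (F : Family L n p) {α : Fin p → ℝ}
    (hU : F.symanzikU α ≠ 0) (b : Fin p) :
    HasDerivAt (fun s => (F.symanzikU (Function.update α b s) : ℂ))
      (F.symanzikU α * ((F.quadMatrix fun a => (α a : ℂ)).toBlocks₁₁⁻¹ *
        (vecMulVec (F.propVec b) (F.propVec b)).toBlocks₁₁).trace) (α b) := by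
  have isUnit : IsUnit (F.quadMatrix fun a => (α a : ℂ)).toBlocks₁₁.det := by
    simpa [det_quadMatrix_ofReal] using hU
  simp only [← det_quadMatrix_ofReal, quadMatrix_update]
  exact hasDerivAt_comp_sub_ofReal (hasDerivAt_det_add_smul isUnit _) (α b)

theorem Family.hasDerivAt_symanzikF_div_update (F : Family L n p) (x : Scale n p → ℂ)
    {α : Fin p → ℝ} (hU : F.symanzikU α ≠ 0) (b : Fin p) :
    HasDerivAt (fun s => F.symanzikF x (Function.update α b s) /
        (F.symanzikU (Function.update α b s) : ℂ))
      (x (Sum.inr b) - (vecMulVec (F.propVec b) (F.propVec b) *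
        (schurLift (F.quadMatrix fun a => (α a : ℂ)) * extGram x *
          (schurLift (F.quadMatrix fun a => (α a : ℂ)))ᵀ)).trace) (α b) := by
  have isUnit : IsUnit (F.quadMatrix fun a => (α a : ℂ)).toBlocks₁₁.det := by
    simpa [det_quadMatrix_ofReal] using hU
  have hne : ∀ᶠ s in 𝓝 (α b), F.symanzikU (Function.update α b s) ≠ 0 := by
    simpa using (F.hasDerivAt_symanzikU_update hU b).continuousAt.eventually_ne (y := 0)
      (by simpa using hU)
  have mass : HasDerivAt (fun s => ∑ a, x (Sum.inr a) * (Function.update α b s a : ℂ))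
      (x (Sum.inr b)) (α b) := by
    have := hasDerivAt_ev (∑ a, MvPolynomial.C (x (Sum.inr a)) * MvPolynomial.X a) b α
    simpa only [map_sum, map_mul, ev_C, ev_X, MvPolynomial.pderiv_C_mul, MvPolynomial.pderiv_X,
      Pi.single_apply, mul_ite, mul_one, mul_zero, apply_ite, map_zero, Finset.sum_ite_eq,
      Finset.sum_ite_eq', Finset.mem_univ, if_true] using this
  have schur := hasDerivAt_comp_sub_ofReal (hasDerivAt_trace_schurComplement_mul
    (F.quadMatrix_isSymm _) isUnit (vecMulVec (F.propVec b) (F.propVec b)) (extGram x)) (α b)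
  refine (mass.fun_sub schur).congr_of_eventuallyEq (hne.mono fun s hs => ?_)
  simp only [F.symanzikF_div x hs, quadMatrix_update]

theorem Family.insertProp_gaussian (F : Family L n p) (x : Scale n p → ℂ) (D : ℂ)
    {α : Fin p → ℝ} (hU : 0 < F.symanzikU α) (b : Fin p) :
    insertProp b (F.gaussian x D) α = F.gaussian x D α *
      F.invPropValue (F.gaussMean x D α) (fun a => x (Sum.inr a)) b := by
  have hdet := F.hasDerivAt_symanzikU_update hU.ne' b
  have hpos : ∀ᶠ s in 𝓝 (α b), 0 < F.symanzikU (Function.update α b s) := by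
    simpa using (Complex.continuous_re.continuousAt.comp hdet.continuousAt).eventually
      (lt_mem_nhds (by simpa using hU))
  have hpow : HasDerivAt (fun s => (F.symanzikU (Function.update α b s) : ℂ) ^ (-D / 2)) _ (α b) :=
    HasDerivAt.comp (h₂ := fun u : ℂ => u ^ (-D / 2)) (α b)
      (Complex.hasStrictDerivAt_cpow_const (Or.inl (by simpa using hU))).hasDerivAt hdet
  have hexp := ((F.hasDerivAt_symanzikF_div_update x hU.ne' b).const_mul (-Complex.I)).cexp
  have hgauss := (hpow.fun_mul hexp).congr_of_eventuallyEq
    (f₁ := fun s => F.gaussian x D (Function.update α b s))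
    (hpos.mono fun s hs => by simp only [gaussian, if_pos hs, mul_div_assoc])
  have hU' : (F.symanzikU α : ℂ) ≠ 0 := by exact_mod_cast hU.ne'
  rw [insertProp, hgauss.deriv, invPropValue_gaussMean, trace_mul_gaussMoment, gaussian, if_pos hU,
    Function.update_eq_self, mul_div_assoc, Complex.cpow_sub _ _ hU', Complex.cpow_one]
  field_simp
  ring_nf
  rw [Complex.I_sq]
  ring

end Wick

/-! ### The relation for convergent integrals -/

section Relation

open Filter MeasureTheory

theorem eventually_comap_re_atTop {P : ℂ → Prop} :
    (∀ᶠ ε in comap Complex.re atTop, P ε) ↔ ∃ R : ℝ, ∀ ε : ℂ, R < ε.re → P ε := by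
  simp [(atTop_basis_Ioi.comap Complex.re).eventually_iff]

theorem eventually_single_mem_regular (D₀ : ℕ) (N : ℕ) (P : MvPolynomial (Fin p) ℂ) :
    ∀ᶠ ε : ℂ in comap Complex.re atTop,
      Finsupp.single (-((D₀ : ℂ) - 2 * ε) / 2) P ∈ regular p N := by
  refine eventually_comap_re_atTop.2 ⟨2 * N + D₀ / 2, fun ε hε => single_mem_regular ?_ P⟩
  have re_eq : (-((D₀ : ℂ) - 2 * ε) / 2).re = ε.re - D₀ / 2 := by
    rw [show -((D₀ : ℂ) - 2 * ε) / 2 = ε - ((D₀ / 2 : ℝ) : ℂ) by push_cast; ring,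
      Complex.sub_re, Complex.ofReal_re]
  linarith

/-- The combination of insertions into the Gaussian function `g` that represents the total
derivative with respect to `k_i` in the direction of the momentum `t`, with the Schwinger parameter
`α_a` in place of the shift `a⁺` and the derivative `i ∂ / ∂ α_b` in place of the shift `b⁻`. -/
def Family.ibpSum (F : Family L n p) (l : Mom L n → Mom L n → Fin p → MvPolynomial (Scale n p) ℚ)
    (r : Mom L n → Mom L n → MvPolynomial (Scale n p) ℚ) (x : Scale n p → ℂ) (D : ℂ) (i : Fin L)
    (t : Mom L n) (g : GaussSum p) : GaussSum p :=
  (if t = Sum.inl i then D else 0) • g +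
    ∑ a, ∑ u, (2 * (F.coeff a (Sum.inl i) : ℂ) * F.coeff a u * Complex.I) •
      (∑ b, MvPolynomial.aeval x (l t u b) • mulParam a (insertFormal F.polyU (F.polyF x) b g) +
        MvPolynomial.aeval x (r t u) • mulParam a g)

theorem Family.ibpSum_mem_regular (F : Family L n p) (l r) (x : Scale n p → ℂ) (D : ℂ) (i : Fin L)
    (t : Mom L n) {N : ℕ} {g : GaussSum p} (hg : g ∈ regular p (N + 1)) :
    F.ibpSum l r x D i t g ∈ regular p N := by
  have hg' : g ∈ regular p N := regular_anti N.le_succ hg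
  refine add_mem (Submodule.smul_mem _ _ hg') (sum_mem fun a _ => sum_mem fun u _ =>
    Submodule.smul_mem _ _ (add_mem (sum_mem fun b _ => Submodule.smul_mem _ _ ?_)
      (Submodule.smul_mem _ _ (mulParam_mem_regular hg' a))))
  exact mulParam_mem_regular (insertFormal_mem_regular hg b) a

/- Where `U > 0`, the sum evaluates to the Gaussian expectation value of the total derivative, which
vanishes by `mul_gaussMoment_inl`. -/
theorem Family.Reduces.realize_ibpSum {F : Family L n p} {l r} (h : F.Reduces l r)
    {x : Scale n p → ℂ} {δ : ℝ} (hd : IsDamped F.polyU (F.polyF x) δ) {D : ℂ}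
    (hg : Finsupp.single (-D / 2) 1 ∈ regular p 1) (i : Fin L) (t : Mom L n) :
    realize F.polyU (F.polyF x) (F.ibpSum l r x D i t (Finsupp.single (-D / 2) 1)) = 0 := by
  funext α
  by_cases hU : 0 < F.symanzikU α
  swap
  · rw [realize_apply]
    exact Finset.sum_eq_zero fun z _ => by
      rw [gaussTerm_apply, ev_polyU, Complex.ofReal_re, if_neg hU]
  have insertion (b : Fin p) : realize F.polyU (F.polyF x)
      (insertFormal F.polyU (F.polyF x) b (Finsupp.single (-D / 2) 1)) α = F.gaussian x D α *
        F.invPropValue (F.gaussMean x D α) (fun a => x (Sum.inr a)) b := by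
    rw [← hd.insertProp_realize hg, ← gaussian_eq_realize, F.insertProp_gaussian x D hU]
  have summand (a : Fin p) (u : Mom L n) : realize F.polyU (F.polyF x)
      (∑ b, MvPolynomial.aeval x (l t u b) • mulParam a
          (insertFormal F.polyU (F.polyF x) b (Finsupp.single (-D / 2) 1)) +
        MvPolynomial.aeval x (r t u) • mulParam a (Finsupp.single (-D / 2) 1)) α =
      F.gaussian x D α * (α a * F.gaussMean x D α s(t, u)) := by
    rw [h.eval (F.gaussMean x D α) x (F.gaussMean_inr x D α) t u]
    simp only [map_add, map_sum, map_smul, Pi.add_apply, Finset.sum_apply, Pi.smul_apply,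
      realize_mulParam, insertion, ← gaussian_eq_realize, smul_eq_mul, mul_add, Finset.mul_sum]
    refine congrArg₂ _ (Finset.sum_congr rfl fun b _ => ?_) ?_ <;> ring
  calc realize F.polyU (F.polyF x) (F.ibpSum l r x D i t (Finsupp.single (-D / 2) 1)) α
      = F.gaussian x D α * ((if t = Sum.inl i then D else 0) + 2 * Complex.I *
          ∑ a, ∑ u, (α a : ℂ) * F.coeff a (Sum.inl i) * F.coeff a u *
            F.gaussMean x D α s(t, u)) := by
        rw [ibpSum, map_add, map_smul, ← gaussian_eq_realize]
        simp only [map_sum, Pi.add_apply, Finset.sum_apply, Pi.smul_apply, map_smul, summand,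
          smul_eq_mul, mul_add, Finset.mul_sum]
        refine congrArg₂ _ (mul_comm _ _) (Finset.sum_congr rfl fun a _ =>
          Finset.sum_congr rfl fun u _ => ?_)
        ring
    _ = 0 := by
        rw [F.sum_param_mul_gaussMean x D hU.ne']
        split_ifs
        · linear_combination F.gaussian x D α * D * Complex.I_sq
        · simp

theorem numeratorDegree_add_single_le (ν : Fin p → ℤ) (a : Fin p) :
    numeratorDegree (ν + Pi.single a 1) ≤ numeratorDegree ν := by
  refine Finset.sum_le_sum fun b _ => Int.toNat_le_toNat (neg_le_neg ?_)
  rcases eq_or_ne b a with rfl | h <;> simp [*]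

theorem Family.sum_ibpCoeff_mul_schwingerFunctional (F : Family L n p) (l r) (D₀ : ℕ)
    {x : Scale n p → ℂ} {δ : ℝ} (hd : IsDamped F.polyU (F.polyF x) δ) (hδ : 0 < δ) (i : Fin L)
    (t : Mom L n) {ν : Fin p → ℤ} (ε : ℂ) {g : GaussSum p}
    (hg : g ∈ regular p (numeratorDegree ν + 1)) :
    ((F.ibpCoeff l r D₀ i t).sum fun s b => Coeff.eval b x ν ε *
      schwingerFunctional F.polyU (F.polyF x) (ν + s) g) =
      schwingerFunctional F.polyU (F.polyF x) ν (F.ibpSum l r x (D₀ - 2 * ε) i t g) := by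
  obtain ⟨Λ, hΛ⟩ := hd.exists_dual_eq_schwingerFunctional hδ ν
  have hg' : g ∈ regular p (numeratorDegree ν) := regular_anti (Nat.le_succ _) hg
  have raise (a : Fin p) : Λ (mulParam a g) = -Complex.I * ν a *
      schwingerFunctional F.polyU (F.polyF x) (ν + Pi.single a 1) g := by
    rw [hΛ _ (mulParam_mem_regular hg' a), schwingerFunctional_mulParam]
  have raise_lower (a b : Fin p) : Λ (mulParam a (insertFormal F.polyU (F.polyF x) b g)) =
      -Complex.I * ν a *
        schwingerFunctional F.polyU (F.polyF x) (ν + (Pi.single a 1 - Pi.single b 1)) g := by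
    have hga : g ∈ regular p (numeratorDegree (ν + Pi.single a 1) + 1) :=
      regular_anti (Nat.succ_le_succ (numeratorDegree_add_single_le ν a)) hg
    rw [hΛ _ (mulParam_mem_regular (insertFormal_mem_regular hg b) a),
      schwingerFunctional_mulParam, hd.schwingerFunctional_insertFormal hδ hga, add_sub_assoc]
  rw [F.sum_ibpCoeff l r D₀ i t x ν ε
      fun s => schwingerFunctional F.polyU (F.polyF x) (ν + s) g, add_zero,
    ← hΛ _ (F.ibpSum_mem_regular l r x _ i t hg), ← hΛ _ hg', ibpSum]
  simp only [map_add, map_sum, map_smul, smul_eq_mul, ite_mul, zero_mul, raise,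
    raise_lower]
  refine congrArg₂ _ rfl (Finset.sum_congr rfl fun a _ => Finset.sum_congr rfl fun u _ => ?_)
  simp only [mul_add, Finset.mul_sum]
  refine congrArg₂ _ (Finset.sum_congr rfl fun b _ => ?_) ?_ <;> ring_nf <;>
    simp [Complex.I_sq]

theorem Family.Reduces.schwinger_relation {F : Family L n p} {l r} (h : F.Reduces l r)
    (D₀ : ℕ) (i : Fin L) (t : Mom L n) (x : Scale n p → ℝ) (ν : Fin p → ℤ) {δ : ℝ} (hδ : 0 < δ) :
    ∀ᶠ ε in comap Complex.re atTop,
      (∀ s ∈ (F.ibpCoeff l r D₀ i t).support, IntegrableOn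
        (F.schwingerIntegrand (shiftScales x δ) (ν + s) (D₀ - 2 * ε)) (orthant (ν + s))) ∧
      ((F.ibpCoeff l r D₀ i t).sum fun s b => Coeff.eval b (shiftScales x δ) ν ε *
        F.schwinger D₀ (shiftScales x δ) (ν + s) ε) = 0 := by
  have hd := F.isDamped x δ
  have regular_add : ∀ᶠ ε : ℂ in comap Complex.re atTop, ∀ s ∈ (F.ibpCoeff l r D₀ i t).support,
      Finsupp.single (-((D₀ : ℂ) - 2 * ε) / 2) 1 ∈ regular p (numeratorDegree (ν + s)) :=
    (eventually_all_finset _).2 fun s _ => eventually_single_mem_regular D₀ _ 1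
  filter_upwards [regular_add, eventually_single_mem_regular D₀ (numeratorDegree ν + 1) 1]
    with ε hs hν
  have integrable (s) (hsupp : s ∈ (F.ibpCoeff l r D₀ i t).support) :
      SchwingerIntegrable (ν + s)
        (insertNumerator (ν + s) (F.gaussian (shiftScales x δ) (D₀ - 2 * ε))) := by
    rw [gaussian_eq_realize, hd.insertNumerator_realize (hs s hsupp)]
    exact hd.schwingerIntegrable_insertNumeratorFormal hδ _ (hs s hsupp)
  refine ⟨fun s hsupp => integrableOn_schwingerIntegrand (integrable s hsupp), ?_⟩
  calc
    _ = Complex.exp (Real.eulerMascheroniConstant * L * ε) *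
        Complex.I ^ (-(L : ℂ) * (D₀ - 2 * ε) / 2) *
        (F.ibpCoeff l r D₀ i t).sum fun s b => Coeff.eval b (shiftScales x δ) ν ε *
          schwingerFunctional F.polyU (F.polyF (shiftScales x δ)) (ν + s)
            (Finsupp.single (-((D₀ : ℂ) - 2 * ε) / 2) 1) := by
      rw [Finsupp.mul_sum]
      refine Finset.sum_congr rfl fun s hsupp => ?_
      beta_reduce
      rw [schwinger, integral_schwingerIntegrand (integrable s hsupp), gaussian_eq_realize,
        hd.insertNumerator_realize (hs s hsupp), ← schwingerFunctional]
      ring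
    _ = 0 := by
      rw [F.sum_ibpCoeff_mul_schwingerFunctional l r D₀ hd hδ i t ε hν,
        hd.schwingerFunctional_eq_zero (F.ibpSum_mem_regular l r _ _ i t hν)
          (h.realize_ibpSum hd (regular_anti (Nat.le_add_left 1 _) hν) i t), mul_zero]

end Relation

/-! ### Meromorphic continuation -/

section Continuation

open Filter

theorem eq_zero_of_meromorphicOn_of_eventually_eq_zero {𝕜 E : Type*} [NontriviallyNormedField 𝕜]
    [NormedAddCommGroup E] [NormedSpace 𝕜 E] {f : 𝕜 → E} {U : Set 𝕜} (hf : MeromorphicOn f U)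
    (hU : IsPreconnected U) {z₀ z : 𝕜} (hz₀ : z₀ ∈ U) (hzero : ∀ᶠ w in 𝓝[≠] z₀, f w = 0)
    (hz : z ∈ U) (hcont : ContinuousAt f z) : f z = 0 := by
  have order_eq_top : meromorphicOrderAt f z = ⊤ := by
    by_contra hne
    exact hf.meromorphicOrderAt_ne_top_of_isPreconnected hU hz hz₀ hne
      (meromorphicOrderAt_eq_top_iff.2 hzero)
  exact tendsto_nhds_unique (hcont.tendsto.mono_left nhdsWithin_le_nhds)
    (tendsto_const_nhds.congr' ((meromorphicOrderAt_eq_top_iff.1 order_eq_top).mono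
      fun _ hw => hw.symm))

namespace Coeff

theorem analyticAt_eval (b : Coeff n p) (x : Scale n p → ℂ) (ν : Fin p → ℤ) (ε : ℂ) :
    AnalyticAt ℂ (fun ε => b.eval x ν ε) ε := by
  refine AnalyticAt.aeval_mvPolynomial ?_ b
  rintro (e | a | _)
  exacts [analyticAt_const, analyticAt_const, analyticAt_id]

theorem tendsto_eval_shiftScales (b : Coeff n p) (x : Scale n p → ℝ) (ν : Fin p → ℤ) (ε : ℂ) :
    Tendsto (fun δ => b.eval (shiftScales x δ) ν ε) (𝓝 0) (𝓝 (b.eval (fun e => x e) ν ε)) := by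
  have shiftScales_zero : shiftScales x 0 = fun e => (x e : ℂ) := by
    ext (e | a) <;> simp [shiftScales]
  have continuous_eval : Continuous fun δ => b.eval (shiftScales x δ) ν ε := by
    simp only [eval, MvPolynomial.aeval_def, MvPolynomial.eval₂_eq_eval_map]
    refine (MvPolynomial.continuous_eval _).comp (continuous_pi ?_)
    rintro ((e | a) | a | _) <;> simp only [Sum.elim_inl, Sum.elim_inr, shiftScales] <;> fun_prop
  simpa [shiftScales_zero] using continuous_eval.tendsto 0

theorem meromorphicOn_sum_eval_mul (c : (Fin p → ℤ) →₀ Coeff n p) (x : Scale n p → ℂ)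
    (ν : Fin p → ℤ) {g : (Fin p → ℤ) → ℂ → ℂ} {U : Set ℂ}
    (hg : ∀ s ∈ c.support, MeromorphicOn (g s) U) :
    MeromorphicOn (fun ε => c.sum fun s b => b.eval x ν ε * g s ε) U := fun ε hε =>
  MeromorphicAt.fun_sum fun s hs =>
    ((c s).analyticAt_eval x ν ε).meromorphicAt.fun_mul (hg s hs ε hε)

theorem continuousAt_sum_eval_mul (c : (Fin p → ℤ) →₀ Coeff n p) (x : Scale n p → ℂ)
    (ν : Fin p → ℤ) {g : (Fin p → ℤ) → ℂ → ℂ} {ε : ℂ}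
    (hg : ∀ s ∈ c.support, ContinuousAt (g s) ε) :
    ContinuousAt (fun ε => c.sum fun s b => b.eval x ν ε * g s ε) ε :=
  tendsto_finsetSum _ fun s hs => ((c s).analyticAt_eval x ν ε).continuousAt.mul (hg s hs)

end Coeff

theorem relation_of_eventually_comap_re_atTop {c : (Fin p → ℤ) →₀ Coeff n p} {x : Scale n p → ℂ}
    {ν : Fin p → ℤ} {J S : (Fin p → ℤ) → ℂ → ℂ}
    (hJ : ∀ s ∈ c.support, MeromorphicOn (J s) Set.univ ∧
      ∀ᶠ ε in comap Complex.re atTop, J s ε = S s ε)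
    (hS : ∀ᶠ ε in comap Complex.re atTop, (c.sum fun s b => b.eval x ν ε * S s ε) = 0)
    {ε : ℂ} (hε : ∀ s ∈ c.support, ContinuousAt (J s) ε) :
    (c.sum fun s b => b.eval x ν ε * J s ε) = 0 := by
  have hzero : ∀ᶠ w in comap Complex.re atTop, (c.sum fun s b => b.eval x ν w * J s w) = 0 := by
    filter_upwards [hS, (eventually_all_finset _).2 fun s hs => (hJ s hs).2] with w hw hJw
    rw [← hw]
    exact Finset.sum_congr rfl fun s hs => congrArg _ (hJw s hs)
  obtain ⟨R, hR⟩ := eventually_comap_re_atTop.1 hzero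
  have near : ∀ᶠ w : ℂ in 𝓝 ((R + 1 : ℝ) : ℂ), R < w.re :=
    Complex.continuous_re.continuousAt.eventually (lt_mem_nhds (by simp))
  exact eq_zero_of_meromorphicOn_of_eventually_eq_zero
    (Coeff.meromorphicOn_sum_eval_mul c x ν fun s hs => (hJ s hs).1) isPreconnected_univ
    (Set.mem_univ _) ((near.mono hR).filter_mono nhdsWithin_le_nhds) (Set.mem_univ ε)
    (Coeff.continuousAt_sum_eval_mul c x ν hε)

theorem Family.relation_of_isFeynmanIntegral (F : Family L n p) (D₀ : ℕ)
    {c : (Fin p → ℤ) →₀ Coeff n p} {x : Scale n p → ℝ} {ν : Fin p → ℤ}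
    (hrel : ∀ δ : ℝ, 0 < δ → ∀ᶠ ε in comap Complex.re atTop,
      (c.sum fun s b => b.eval (shiftScales x δ) ν ε *
        F.schwinger D₀ (shiftScales x δ) (ν + s) ε) = 0)
    {I : (Fin p → ℤ) → ℂ → ℂ} (hI : ∀ s ∈ c.support, F.IsFeynmanIntegral D₀ x (ν + s) (I s))
    {ε : ℂ} (hε : ∀ s ∈ c.support, ContinuousAt (I s) ε) :
    (c.sum fun s b => b.eval (fun e => (x e : ℂ)) ν ε * I s ε) = 0 := by
  choose! hmer J hJ R hR using hI
  have hJzero (δ : ℝ) (hδ : 0 < δ) (w : ℂ) (hw : ∀ s ∈ c.support, AnalyticAt ℂ (J s δ) w) :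
      (c.sum fun s b => b.eval (shiftScales x δ) ν w * J s δ w) = 0 :=
    relation_of_eventually_comap_re_atTop (fun s hs => (hJ s hs δ hδ).imp_right
      eventually_comap_re_atTop.2) (hrel δ hδ) fun s hs => (hw s hs).continuousAt
  have hIzero (w : ℂ) (hre : ∀ s ∈ c.support, w.re < R s) (him : w.im ≠ 0) :
      (c.sum fun s b => b.eval (fun e => (x e : ℂ)) ν w * I s w) = 0 := by
    have limit : Tendsto (fun δ => c.sum fun s b => b.eval (shiftScales x δ) ν w * J s δ w)
        (𝓝[>] 0) (𝓝 (c.sum fun s b => b.eval (fun e => (x e : ℂ)) ν w * I s w)) :=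
      tendsto_finsetSum _ fun s hs =>
        (((c s).tendsto_eval_shiftScales x ν w).mono_left nhdsWithin_le_nhds).mul
          (hR s hs w (hre s hs) him).2
    have analytic : ∀ᶠ δ in 𝓝[>] (0 : ℝ), ∀ s ∈ c.support, AnalyticAt ℂ (J s δ) w :=
      (eventually_all_finset _).2 fun s hs => (hR s hs w (hre s hs) him).1
    refine tendsto_nhds_unique (limit.congr' ?_) tendsto_const_nhds
    filter_upwards [analytic, self_mem_nhdsWithin] with δ hδw hδ using hJzero δ hδ w hδw
  obtain ⟨M, hM⟩ := (c.support.finite_toSet.image R).bddBelow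
  have near : ∀ᶠ w : ℂ in 𝓝 (((M - 1 : ℝ) : ℂ) + Complex.I), w.re < M ∧ w.im ≠ 0 :=
    (Complex.continuous_re.continuousAt.eventually (gt_mem_nhds (by simp))).and
      (Complex.continuous_im.continuousAt.eventually_ne (by simp))
  exact eq_zero_of_meromorphicOn_of_eventually_eq_zero
    (Coeff.meromorphicOn_sum_eval_mul c _ ν hmer) isPreconnected_univ (Set.mem_univ _)
    ((near.mono fun w hw => hIzero w (fun s hs =>
      hw.1.trans_le (hM (Set.mem_image_of_mem R hs))) hw.2).filter_mono nhdsWithin_le_nhds)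
    (Set.mem_univ ε) (Coeff.continuousAt_sum_eval_mul c _ ν hε)

end Continuation

end

end Feynman

theorem mainTheorem4_general {L n p : ℕ} (F : Feynman.Family L n p) (hF : F.IsComplete) (D₀ : ℕ)
    (i : Fin L) (t : Feynman.Mom L n) :
    ∃ c : (Fin p → ℤ) →₀ Feynman.Coeff n p, c ≠ 0 ∧
      (∀ (d : ℕ) (P : Fin n → Fin d → ℝ) (m2 : Fin p → ℝ) (δ : ℝ),
        δ ≠ 0 → ∀ (ν : Fin p → ℤ) (k : Fin L → Fin d → ℝ),
          Feynman.totalDerivative P i t (F.integrand P m2 δ ν) k =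
            c.sum fun s b =>
              Feynman.Coeff.eval b (Feynman.shiftScales (Feynman.scalesOf P m2) δ) ν
                (((D₀ : ℂ) - d) / 2) * F.integrand P m2 δ (ν + s) k) ∧
      ∀ (x : Feynman.Scale n p → ℝ) (ν : Fin p → ℤ),
        (∀ δ : ℝ, 0 < δ → ∃ R : ℝ, ∀ ε : ℂ, R < ε.re →
          (∀ s ∈ c.support, MeasureTheory.IntegrableOn
            (F.schwingerIntegrand (Feynman.shiftScales x δ) (ν + s) (D₀ - 2 * ε))
            (Feynman.orthant (ν + s))) ∧
          (c.sum fun s b => Feynman.Coeff.eval b (Feynman.shiftScales x δ) ν ε *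
            F.schwinger D₀ (Feynman.shiftScales x δ) (ν + s) ε) = 0) ∧
        (∀ I : (Fin p → ℤ) → ℂ → ℂ,
          (∀ s ∈ c.support, F.IsFeynmanIntegral D₀ x (ν + s) (I (ν + s))) →
          ∀ ε : ℂ, (∀ s ∈ c.support, AnalyticAt ℂ (I (ν + s)) ε) →
            (c.sum fun s b => Feynman.Coeff.eval b (fun e => (x e : ℂ)) ν ε *
              I (ν + s) ε) = 0) := by
  obtain ⟨l, r, h⟩ := hF.exists_reduces
  refine ⟨F.ibpCoeff l r D₀ i t, h.ibpCoeff_ne_zero D₀ i t,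
    fun d P m2 δ hδ ν k => h.totalDerivative_eq D₀ i t P m2 hδ ν k, fun x ν =>
      ⟨fun δ hδ => Feynman.eventually_comap_re_atTop.1 (h.schwinger_relation D₀ i t x ν hδ),
        fun I hI ε hε => ?_⟩⟩
  exact F.relation_of_isFeynmanIntegral D₀
    (fun δ hδ => (h.schwinger_relation D₀ i t x ν hδ).mono fun _ hw => hw.2) hI
    fun s hs => (hε s hs).continuousAt

theorem mainTheorem4 {L n p : ℕ} (F : Feynman.Family L n p) (hF : F.IsComplete) (D₀ : ℕ)
    (i : Fin L) (t : Feynman.Mom L n) :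
    ∃ c : (Fin p → ℤ) →₀ Feynman.Coeff n p, c ≠ 0 ∧
      -- the total derivative with respect to `k_i`, in direction of the momentum `t`, of every
      -- integrand is a combination of integrands with shifted exponents, in every dimension `d`
      (∀ (d : ℕ) (P : Fin n → Fin d → ℝ) (m2 : Fin p → ℝ), (∀ a, 0 ≤ m2 a) →
        ∀ (δ : ℝ), 0 < δ → ∀ (ν : Fin p → ℤ) (k : Fin L → Fin d → ℝ),
          Feynman.totalDerivative P i t (F.integrand P m2 δ ν) k =
            c.sum fun s b =>
              Feynman.Coeff.eval b (Feynman.shiftScales (Feynman.scalesOf P m2) δ) ν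
                (((D₀ : ℂ) - d) / 2) * F.integrand P m2 δ (ν + s) k) ∧
      ∀ x : Feynman.Scale n p → ℝ, (∀ a, 0 ≤ x (Sum.inr a)) → ∀ ν : Fin p → ℤ,
        -- the corresponding relation, for convergent integrals
        (∀ δ : ℝ, 0 < δ → ∃ R : ℝ, ∀ ε : ℂ, R < ε.re →
          (∀ s ∈ c.support, MeasureTheory.IntegrableOn
            (F.schwingerIntegrand (Feynman.shiftScales x δ) (ν + s) (D₀ - 2 * ε))
            (Feynman.orthant (ν + s))) ∧
          (c.sum fun s b => Feynman.Coeff.eval b (Feynman.shiftScales x δ) ν ε *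
            F.schwinger D₀ (Feynman.shiftScales x δ) (ν + s) ε) = 0) ∧
        -- the corresponding relation, for dimensionally regularised integrals
        (∀ I : (Fin p → ℤ) → ℂ → ℂ,
          (∀ s ∈ c.support, F.IsFeynmanIntegral D₀ x (ν + s) (I (ν + s))) →
          ∀ ε : ℂ, (∀ s ∈ c.support, AnalyticAt ℂ (I (ν + s)) ε) →
            (c.sum fun s b => Feynman.Coeff.eval b (fun e => (x e : ℂ)) ν ε *
              I (ν + s) ε) = 0) := by
  obtain ⟨c, hc, hderiv, hrel⟩ := mainTheorem4_general F hF D₀ i t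
  exact ⟨c, hc, fun d P m2 _ δ hδ => hderiv d P m2 δ hδ.ne', fun x _ => hrel x⟩
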